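/- \textbf{Setting.} Let $\mathbb F_q$ be a finite field, $\alpha_1,\dots,\alpha_n\in\mathbb F_q$ distinct, $\lambda_1,\dots,\lambda_n\ge 1$, $M=\prod_j(x-\alpha_j)^{\lambda_j}$, $L=\sum_j\lambda_j$, $\ell\ge 1$, and $d_f,d_g\ge 1$ with $d_f+d_g\le L+1$. For a polynomial $p$, or a polynomial modulo $(x-\alpha_j)^{\lambda_j}$, let $\nu_{\alpha_j}(p)$ be the largest $m\le\lambda_j$ with $(x-\alpha_j)^m\mid p$; for a vector take the minimum over the coordinates. The degree of a vector is the maximal degree of its coordinates. A received word is $R=(\rho_j,r_j)_{1\le j\le n}$ with $0\le\rho_j\le\lambda_j$ and $r_j\in(\mathbb F_q[x]/(x-\alpha_j)^{\lambda_j})^\ell$. It is reduced if $\gcd(r_j,(x-\alpha_j)^{\rho_j})=1$ for all $j$. Received words are always taken reduced, and $(\rho_j,r_j)_j$, $(\rho'_j,r'_j)_j$ are identified when $(x-\alpha_j)^{\rho'_j}r_j\equiv(x-\alpha_j)^{\rho_j}r'_j \bmod (x-\alpha_j)^{\lambda_j}$ for all $j$. For $f=(f_1,\dots,f_\ell)\in\mathbb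 F_q[x]^\ell$ and $0\ne g\in\mathbb F_q[x]$ with $\gcd(f_1,\dots,f_\ell,g)=1$, put $\nu_j=\nu_{\alpha_j}(g)$ and $\mathrm{Ev}^\infty(f/g)_j=(\nu_j,S_j)$, where $S_j=f/(g/(x-\alpha_j)^{\nu_j})\bmod (x-\alpha_j)^{\lambda_j-\nu_j}$, and $S_j=(1,\dots,1)$ if $\nu_j=\lambda_j$. \textbf{Decoder.} On input $R$ and a distance parameter $t\in\mathbb N$: choose a nonzero $(\varphi,\psi_1,\dots,\psi_\ell)\in\mathbb F_q[x]^{\ell+1}$ with $\max\{\deg\varphi,\deg\psi\}$ minimal among the nonzero tuples with $(x-\alpha_j)^{\rho_j}\psi_i\equiv\varphi\, r_{i,j}\bmod (x-\alpha_j)^{\lambda_j}$ for all $i,j$, $\deg\varphi<d_g+t$ and $\deg\psi<d_f+t$. Let $\eta=\gcd(\varphi,\psi_1,\dots,\psi_\ell)$, $\varphi'=\varphi/\eta$, $\psi'=\psi/\eta$. If $\deg\eta\le t$, $\deg\varphi'<d_g$ and $\deg\psi'<d_f$, return $\psi'/\varphi'$; otherwise return ``decoding failure''. \textbf{Error model.}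 Fix $f/g$ as above with $\deg f<d_f$ and $\deg g<d_g$; disjoint sets $\xi_{m,e},\xi_v\subseteq\{1,\dots,n\}$ (maximal evaluation error support and valuation error support); integers $\mu_j\ge 0$ with $\mu_j=\lambda_j$ for $j\notin\xi_{m,e}\cup\xi_v$, $\nu_j\le\mu_j<\lambda_j$ for $j\in\xi_{m,e}$, and $\mu_j\le\nu_j$, $\mu_j<\lambda_j$ for $j\in\xi_v$; and reduced entries $\mathfrak R_j=(\rho_j,r_j)$ for $j\in\xi_v$, with $\rho_j=\mu_j$ if $\mu_j<\nu_j$ and $\rho_j>\nu_j$ if $\mu_j=\nu_j$. Put $\Lambda_{m,e}=\prod_{j\in\xi_{m,e}}(x-\alpha_j)^{\lambda_j-\mu_j}$ and $\Lambda_v=\prod_{j\in\xi_v}(x-\alpha_j)^{\lambda_j-\mu_j}$. Let $\mathcal B^2$ be the (finite, nonempty) set of reduced received words $R$ with (1) $R_j=\mathrm{Ev}^\infty(f/g)_j$ for $j\notin\xi_{m,e}\cup\xi_v$; (2) $R_j=\mathfrak R_j$ for $j\in\xi_v$; (3) $R_j=(\nu_j,r_j)$ with $\nu_{\alpha_j}(r_j-S_j)\ge\mu_j-\nu_j$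 for $j\in\xi_{m,e}$. \textbf{Theorem.} Let $t_v,t_e\in\mathbb N$ with $t_v\le\left\lfloor\frac{L-d_f-d_g+1}{2}\right\rfloor$ and $t_e\le\bar t_e:=\frac{\ell}{\ell+1}\,[L-d_f-d_g+1-2t_v]$, and suppose that $\deg\Lambda_v\le t_v$ and $\deg\Lambda_{m,e}\le t_e$. If $R$ is uniformly distributed in $\mathcal B^2$, then the decoder with distance parameter $t=t_v+t_e$ outputs $f/g$, whichever minimal solution it chooses, except with probability $$\mathbb P_{fail}\le q^{-(\ell+1)(\bar t_e-t_e)}\prod_{\alpha\in\mathcal Z(\Lambda_{m,e})}\frac{1-1/q^{\ell+\nu_\alpha(\Lambda_{m,e})}}{1-1/q^{\ell+1}},$$ where $\mathcal Z(\Lambda_{m,e})$ is the set of roots of $\Lambda_{m,e}$ in $\mathbb F_q$ and $\nu_\alpha(\Lambda_{m,e})$ is the multiplicity of the root $\alpha$. -/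

import Mathlib

open Polynomial

namespace SRFPoles

noncomputable section

variable {F : Type*} [Field F]

/-- The ring `F[x] / (x - a)^k`. -/
abbrev LocalRing (a : F) (k : ℕ) : Type _ := F[X] ⧸ Ideal.span {(X - C a) ^ k}

/-- Reduction of a polynomial modulo `(x - a)^k`. -/
def red (a : F) (k : ℕ) (p : F[X]) : LocalRing a k := Ideal.Quotient.mk _ p

/-- The class of `x - a` in `F[x] / (x - a)^k`. -/
def unif (a : F) (k : ℕ) : LocalRing a k := red a k (X - C a)

open Classical in
/-- The truncated valuation `min (Val_a p) k` of a polynomial, where `Val_a 0 = ∞`. -/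
def polyVal (a : F) (k : ℕ) (p : F[X]) : ℕ :=
  if p = 0 then k else min (p.rootMultiplicity a) k

open Classical in
/-- The truncated valuation of a vector over `F[x] / (x - a)^k`: the largest `m ≤ k` such that
`(x - a)^m` divides all the coordinates. -/
def vecVal {a : F} {k l : ℕ} (r : Fin l → LocalRing a k) : ℕ :=
  Nat.findGreatest (fun m => ∀ i, unif a k ^ m ∣ r i) k

/-- One entry `(ρ, r)` of a received word at the point `a` with multiplicity `k`: a valuation
`0 ≤ ρ ≤ k` and a vector `r` over `F[x] / (x - a)^k`. -/
structure LocalWord (a : F) (k l : ℕ) where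
  /-- the valuation part `ρ` -/
  rho : Fin (k + 1)
  /-- the reduction part `r` -/
  vec : Fin l → LocalRing a k

/-- The entry `(ρ, r)` is reduced: `gcd (r, (x - a)^ρ) = (x - a)^(min (ν r) ρ)` is `1`. -/
def LocalWord.IsReduced {a : F} {k l : ℕ} (w : LocalWord a k l) : Prop :=
  min (vecVal w.vec) (w.rho : ℕ) = 0

/-- `(ρ, r) ~ (ρ', r')` when `(x - a)^ρ' r = (x - a)^ρ r'` modulo `(x - a)^k`. -/
def LocalWord.Equiv {a : F} {k l : ℕ} (w w' : LocalWord a k l) : Prop :=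
  ∀ i, unif a k ^ (w'.rho : ℕ) * w.vec i = unif a k ^ (w.rho : ℕ) * w'.vec i

/-- Received words (through representatives): one entry for each evaluation point. -/
abbrev Word {n : ℕ} (α : Fin n → F) (lam : Fin n → ℕ) (l : ℕ) : Type _ :=
  ∀ j, LocalWord (α j) (lam j) l

/-- The polynomials `f₁, …, f_l, g` have no common factor. -/
def CoprimeFamily {l : ℕ} (f : Fin l → F[X]) (g : F[X]) : Prop :=
  ∀ d : F[X], d ∣ g → (∀ i, d ∣ f i) → IsUnit d

/-- A representative modulo `(x - a)^k` of the vector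
`f / (g / (x - a)^ν) mod (x - a)^(k - ν)`, where `ν` is the truncated valuation of `g`.
When `ν < k`, `g / (x - a)^ν` is invertible modulo `(x - a)^k`. When `ν = k` the vector is set to
be `(1, …, 1)`. -/
def evVec {l : ℕ} (a : F) (k : ℕ) (f : Fin l → F[X]) (g : F[X]) : Fin l → LocalRing a k :=
  if polyVal a k g = k then fun _ => 1
  else fun i => red a k (f i) * Ring.inverse (red a k (g /ₘ (X - C a) ^ polyVal a k g))

/-- The multi-precision encoding of the vector of fractions `f / g`. -/
def encode {n l : ℕ} (α : Fin n → F) (lam : Fin n → ℕ) (f : Fin l → F[X]) (g : F[X]) :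
    Word α lam l :=
  fun j => ⟨Fin.ofNat (lam j + 1) (polyVal (α j) (lam j) g), evVec (α j) (lam j) f g⟩

/-- The locator polynomial `∏_{j ∈ s} (x - α_j)^(λ_j - μ_j)`. -/
def locator {n : ℕ} (α : Fin n → F) (lam μ : Fin n → ℕ) (s : Finset (Fin n)) : F[X] :=
  ∏ j ∈ s, (X - C (α j)) ^ (lam j - μ j)

/-! ### The decoder -/

/-- The solutions `(φ, ψ)` of the key equations `(x - α_j)^ρ_j ψ_i = φ r_{i,j}` modulo
`(x - α_j)^λ_j`, for all `i, j` (by the Chinese remainder theorem these are congruences modulo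
`M = ∏_j (x - α_j)^λ_j`), with `deg φ < d_g + t` and `deg ψ_i < d_f + t`. -/
def IsSolution {n l : ℕ} {α : Fin n → F} {lam : Fin n → ℕ} (df dg t : ℕ) (R : Word α lam l)
    (φ : F[X]) (ψ : Fin l → F[X]) : Prop :=
  (∀ i j, unif (α j) (lam j) ^ ((R j).rho : ℕ) * red (α j) (lam j) (ψ i)
      = red (α j) (lam j) φ * (R j).vec i) ∧
    φ.degree < ((dg + t : ℕ) : WithBot ℕ) ∧ ∀ i, (ψ i).degree < ((df + t : ℕ) : WithBot ℕ)

/-- `max {deg φ, deg ψ₁, …, deg ψ_l}`. -/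
def maxDegree {l : ℕ} (φ : F[X]) (ψ : Fin l → F[X]) : WithBot ℕ :=
  max φ.degree (Finset.univ.sup fun i => (ψ i).degree)

/-- `(φ, ψ)` is a nonzero solution of the key equations of minimal degree. -/
def IsMinimalSolution {n l : ℕ} {α : Fin n → F} {lam : Fin n → ℕ} (df dg t : ℕ)
    (R : Word α lam l) (φ : F[X]) (ψ : Fin l → F[X]) : Prop :=
  IsSolution df dg t R φ ψ ∧ ¬ (φ = 0 ∧ ψ = 0) ∧
    ∀ (φ₁ : F[X]) (ψ₁ : Fin l → F[X]), IsSolution df dg t R φ₁ ψ₁ → ¬ (φ₁ = 0 ∧ ψ₁ = 0) →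
      maxDegree φ ψ ≤ maxDegree φ₁ ψ₁

/-- `η` is a greatest common divisor of `φ, ψ₁, …, ψ_l`. -/
def IsVecGcd {l : ℕ} (φ : F[X]) (ψ : Fin l → F[X]) (η : F[X]) : Prop :=
  (η ∣ φ ∧ ∀ i, η ∣ ψ i) ∧ ∀ d : F[X], d ∣ φ → (∀ i, d ∣ ψ i) → d ∣ η

open Classical in
/-- `out` is a possible result of the decoder on the received word `R` with distance parameter
`t`: for some nonzero solution `(φ, ψ) = (η φ', η ψ')` of minimal degree, with `η` the gcd, the
decoder returns `(φ', ψ')`, standing for the vector of fractions `ψ' / φ'`, if `deg η ≤ t`,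
`deg φ' < d_g` and `deg ψ'_i < d_f`, and it returns `none` ("decoding failure") otherwise. -/
def IsDecoderOutput {n l : ℕ} {α : Fin n → F} {lam : Fin n → ℕ} (df dg t : ℕ)
    (R : Word α lam l) (out : Option (F[X] × (Fin l → F[X]))) : Prop :=
  ∃ (φ : F[X]) (ψ : Fin l → F[X]) (η φ' : F[X]) (ψ' : Fin l → F[X]),
    IsMinimalSolution df dg t R φ ψ ∧ IsVecGcd φ ψ η ∧ φ = η * φ' ∧ (∀ i, ψ i = η * ψ' i) ∧
    out = if η.degree ≤ (t : WithBot ℕ) ∧ φ'.degree < (dg : WithBot ℕ) ∧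
        ∀ i, (ψ' i).degree < (df : WithBot ℕ) then some (φ', ψ') else none

/-- The result `out` of the decoder is the vector of fractions `f / g`. -/
def IsFraction {l : ℕ} (f : Fin l → F[X]) (g : F[X]) (out : Option (F[X] × (Fin l → F[X]))) :
    Prop :=
  ∃ (φ' : F[X]) (ψ' : Fin l → F[X]), out = some (φ', ψ') ∧ φ' ≠ 0 ∧ ∀ i, ψ' i * g = f i * φ'

/-- The decoder outputs `f / g` on the received word `R`, whichever solution of minimal degree
it picks. -/
def DecodesTo {n l : ℕ} {α : Fin n → F} {lam : Fin n → ℕ} (df dg t : ℕ) (R : Word α lam l)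
    (f : Fin l → F[X]) (g : F[X]) : Prop :=
  (∃ out, IsDecoderOutput df dg t R out) ∧
    ∀ out, IsDecoderOutput df dg t R out → IsFraction f g out

/-! ### The error model -/

/-- The conditions on the parameters of the hybrid error model around `f / g`: evaluation error
support `ξe`, valuation error support `ξv`, error valuations `μ`, and partial received word `W`
(only its entries at `j ∈ ξv` matter). -/
structure IsErrorPattern {n l : ℕ} {α : Fin n → F} {lam : Fin n → ℕ} (g : F[X])
    (ξe ξv : Finset (Fin n)) (μ : Fin n → ℕ) (W : Word α lam l) : Prop where
  disjoint : Disjoint ξe ξv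
  mu_of_not_mem : ∀ j, j ∉ ξe → j ∉ ξv → μ j = lam j
  mu_of_mem_e : ∀ j ∈ ξe, polyVal (α j) (lam j) g ≤ μ j ∧ μ j < lam j
  mu_of_mem_v : ∀ j ∈ ξv, μ j ≤ polyVal (α j) (lam j) g ∧ μ j < lam j
  rho_of_lt : ∀ j ∈ ξv, μ j < polyVal (α j) (lam j) g → ((W j).rho : ℕ) = μ j
  rho_of_eq : ∀ j ∈ ξv, μ j = polyVal (α j) (lam j) g →
    polyVal (α j) (lam j) g < ((W j).rho : ℕ)
  reduced : ∀ j ∈ ξv, (W j).IsReduced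

/-- The sample space of the second error model: the reduced received words `R = (ρ_j, r_j)_j` such
that `R_j` is the `j`-th entry of the encoding of `f / g` off the error supports, `R_j = W_j` for
`j ∈ ξv`, and `ρ_j = ν_j(g)`, `ν_j(r_j - S_j(f/g)) ≥ μ_j - ν_j(g)` for `j ∈ ξe`.

Words are counted through their reduced representatives. All the words in the set have the same
valuations `ρ_j`, so they all have the same number of reduced representatives (two reduced entries
are equivalent iff they have the same `ρ` and their vectors agree modulo `(x - α_j)^(λ_j - ρ)`);
hence the uniform distribution on representatives induces the uniform distribution on classes. -/
def errorModel {n l : ℕ} {α : Fin n → F} {lam : Fin n → ℕ} (f : Fin l → F[X]) (g : F[X])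
    (ξe ξv : Finset (Fin n)) (μ : Fin n → ℕ) (W : Word α lam l) : Set (Word α lam l) :=
  {R | (∀ j, (R j).IsReduced) ∧
    (∀ j, j ∉ ξe → j ∉ ξv → (R j).Equiv (encode α lam f g j)) ∧
    (∀ j ∈ ξv, (R j).Equiv (W j)) ∧
    (∀ j ∈ ξe, ((R j).rho : ℕ) = polyVal (α j) (lam j) g ∧
      μ j - polyVal (α j) (lam j) g ≤
        vecVal (fun i => (R j).vec i - evVec (α j) (lam j) f g i))}

/-- The probability that a uniformly random element of the finite set `B` satisfies `P`. -/
def uniformProb {Ω : Type*} (B : Set Ω) (P : Ω → Prop) : ℝ :=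
  ({R ∈ B | P R}.ncard : ℝ) / (B.ncard : ℝ)

/-- The maximal distance on the evaluation errors,
`l / (l + 1) * (L - d_f - d_g + 1 - 2 t_v)`. -/
def tbar (l L df dg tv : ℕ) : ℝ :=
  (l : ℝ) / ((l : ℝ) + 1) * ((L : ℝ) - df - dg + 1 - 2 * tv)

end

end SRFPoles

/-!
# Decoding simultaneous rational functions with poles: the failure probability

Write `u_j = x - α_j`, `ν_j` for the valuation of `g`, `S_j` for the encoding of `f / g`,
`m_j = λ_j - μ_j`, `d = ∑ m_j` over the evaluation errors, `Q = q^l` and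
`A = L - d_f - d_g + 1 - 2 t_v`.

If `Λ` is the product of the two locators, `(Λ g, Λ f)` solves the key equations
(`isSolution_locator`). When all the solutions are proportional to `(g, f)`, the minimal ones are
`(e g, e f)` with `deg e ≤ deg Λ ≤ t`, so the decoder succeeds
(`decodesTo_of_forall_isSolution`). Suppose that `(φ, ψ)` is a solution which is not proportional to
`(g, f)`. Then `g ψ - f φ` is a nonzero multiple `Y p` of `Y = ∏ u_j^μ_j`, so that
`deg p < D = t_e + d - A`, and at each evaluation error `r_j = S_j + u_j^(μ_j - ν_j) e_j` one gets
`p = χ_j e_j` modulo `u_j^m_j`, where the multiplier `χ_j` is `φ / u_j^ν_j` times a unit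
(`exists_errorRel_of_not_decodesTo`). In particular `D > 0`, which is impossible for `l = 1`.

It remains to count the words for which some pair `(p, χ)` satisfies such a relation
(`ncard_bad_le`). There are `q^d` choices of `χ`. If `χ_j` has valuation `s_j`, then `p` is a
multiple of `η = ∏ u_j^s_j`, and the relation determines `e_j` modulo `u_j^(m_j - s_j)`. If the
errors `e_j` were uniform, the sum over `p` of the probabilities of the relations would be at most
`Q^(D - deg η) Q^(deg η - d) = Q^(D - d)`, and the sum over `χ` would be
`q^d Q^(D - d) ≤ q^((l + 1) t_e - l A)`, which is the leading factor of the bound. The other factors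
of the bound are at least `1`.

The errors are not quite uniform: when `μ_j = ν_j > 0`, reducedness excludes the `r_j` that vanish
at `α_j`, which raises the conditional probabilities by a factor `(1 - 1/Q)⁻¹`. This is compensated
as follows. At such a point, if `s_j < m_j`, the relation forbids one nonzero value of `p / η` at
`α_j` (`exists_forbidden_value`). Moreover the pairs `(p, χ)` can be scaled by `F^*`, which gains a
factor `q - 1`. As there are at most `q` evaluation points, these two gains suffice
(`ncard_avoid_le`, `sum_prod_le`).
-/

namespace SRFPoles

variable {F : Type*} [Field F]

/-! ### Polynomials modulo a power of `x - a` -/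

theorem red_eq_iff {a : F} {k : ℕ} {p q : F[X]} :
    red a k p = red a k q ↔ (X - C a) ^ k ∣ p - q := by
  unfold red
  rw [Ideal.Quotient.eq, Ideal.mem_span_singleton]

theorem red_surjective (a : F) (k : ℕ) : Function.Surjective (red a k) :=
  Ideal.Quotient.mk_surjective

theorem red_mul (a : F) (k : ℕ) (p q : F[X]) : red a k (p * q) = red a k p * red a k q :=
  map_mul _ _ _

theorem red_add (a : F) (k : ℕ) (p q : F[X]) : red a k (p + q) = red a k p + red a k q :=
  map_add _ _ _

theorem red_sub (a : F) (k : ℕ) (p q : F[X]) : red a k (p - q) = red a k p - red a k q :=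
  map_sub _ _ _

theorem red_pow (a : F) (k s : ℕ) (p : F[X]) : red a k (p ^ s) = red a k p ^ s :=
  map_pow _ _ _

theorem unif_pow (a : F) (k s : ℕ) : unif a k ^ s = red a k ((X - C a) ^ s) := by
  rw [red_pow, unif]

theorem unif_pow_dvd_red {a : F} {k s : ℕ} (hs : s ≤ k) {p : F[X]} :
    unif a k ^ s ∣ red a k p ↔ (X - C a) ^ s ∣ p := by
  constructor
  · rintro ⟨c, hc⟩
    obtain ⟨c, rfl⟩ := red_surjective a k c
    rw [unif_pow, ← red_mul, red_eq_iff] at hc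
    have h := (pow_dvd_pow (X - C a) hs).trans hc
    exact (dvd_sub_left (dvd_mul_right _ _)).1 h
  · rintro ⟨c, rfl⟩
    rw [unif_pow, red_mul]
    exact dvd_mul_right _ _

theorem eval_ne_zero_iff_not_dvd {a : F} {p : F[X]} : p.eval a ≠ 0 ↔ ¬ (X - C a) ∣ p := by
  rw [Ne, dvd_iff_isRoot, IsRoot.def]

theorem isCoprime_of_eval_ne_zero {a : F} {p : F[X]} (h : p.eval a ≠ 0) (s : ℕ) :
    IsCoprime ((X - C a) ^ s) p :=
  ((irreducible_X_sub_C a).coprime_iff_not_dvd.2 (eval_ne_zero_iff_not_dvd.1 h)).pow_left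

theorem X_sub_C_pow_ne_zero (a : F) (s : ℕ) : (X - C a) ^ s ≠ 0 :=
  pow_ne_zero _ (X_sub_C_ne_zero a)

theorem polyVal_le (a : F) (k : ℕ) (p : F[X]) : polyVal a k p ≤ k := by
  unfold polyVal
  split_ifs <;> simp

theorem pow_polyVal_dvd (a : F) (k : ℕ) (p : F[X]) : (X - C a) ^ polyVal a k p ∣ p := by
  unfold polyVal
  split_ifs with h
  · simp [h]
  · exact (pow_dvd_pow _ (min_le_left _ _)).trans (pow_rootMultiplicity_dvd p a)

theorem exists_eq_pow_polyVal_mul {a : F} {k : ℕ} {p : F[X]} (h : polyVal a k p < k) :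
    ∃ p', p = (X - C a) ^ polyVal a k p * p' ∧ p'.eval a ≠ 0 := by
  have hp : p ≠ 0 := by
    rintro rfl
    simp [polyVal] at h
  have hv : polyVal a k p = p.rootMultiplicity a := by
    unfold polyVal at h ⊢
    rw [if_neg hp] at h ⊢
    omega
  obtain ⟨p', h1, h2⟩ := exists_eq_pow_rootMultiplicity_mul_and_not_dvd p hp a
  exact ⟨p', by rwa [hv], eval_ne_zero_iff_not_dvd.2 h2⟩

theorem isUnit_red {a : F} {k : ℕ} {p : F[X]} (h : p.eval a ≠ 0) : IsUnit (red a k p) := by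
  obtain ⟨c, b, hb⟩ := isCoprime_of_eval_ne_zero h k
  refine IsUnit.of_mul_eq_one (red a k b) ?_
  rw [← red_mul, show (1 : LocalRing a k) = red a k 1 from (map_one _).symm, red_eq_iff]
  exact ⟨-c, by linear_combination hb⟩

/-- The defining property of the encoding at a point where the valuation of `g` is not maximal. -/
theorem evVec_spec {l : ℕ} {a : F} {k : ℕ} (f : Fin l → F[X]) {g : F[X]}
    (h : polyVal a k g < k) :
    ∃ g', g = (X - C a) ^ polyVal a k g * g' ∧ g'.eval a ≠ 0 ∧
      ∀ i, red a k g' * evVec a k f g i = red a k (f i) := by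
  obtain ⟨g', h1, h2⟩ := exists_eq_pow_polyVal_mul h
  refine ⟨g', h1, h2, fun i => ?_⟩
  have h3 : g /ₘ (X - C a) ^ polyVal a k g = g' := by
    clear h
    generalize polyVal a k g = s at h1
    rw [h1]
    exact mul_divByMonic_cancel_left _ ((monic_X_sub_C a).pow _)
  unfold evVec
  rw [if_neg h.ne, h3]
  rw [mul_left_comm, Ring.mul_inverse_cancel _ (isUnit_red h2), mul_one]

/-! ### Truncated valuations of vectors and reduced entries -/

theorem pow_dvd_of_le_vecVal {a : F} {k l s : ℕ} {r : Fin l → LocalRing a k}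
    (h : s ≤ vecVal r) (i : Fin l) : unif a k ^ s ∣ r i := by
  classical
  have h0 : ∀ i, unif a k ^ vecVal r ∣ r i := by
    unfold vecVal
    refine Nat.findGreatest_spec (P := fun m => ∀ i, unif a k ^ m ∣ r i) (Nat.zero_le _) ?_
    simp
  exact (pow_dvd_pow _ h).trans (h0 i)

theorem le_vecVal_iff {a : F} {k l s : ℕ} (hs : s ≤ k) {r : Fin l → LocalRing a k} :
    s ≤ vecVal r ↔ ∀ i, unif a k ^ s ∣ r i := by
  classical
  refine ⟨pow_dvd_of_le_vecVal, fun h => ?_⟩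
  unfold vecVal
  exact Nat.le_findGreatest (P := fun m => ∀ i, unif a k ^ m ∣ r i) hs h

theorem isReduced_iff {a : F} {k l : ℕ} {w : LocalWord a k l} :
    w.IsReduced ↔ ((w.rho : ℕ) ≠ 0 → ∃ i, ¬ unif a k ∣ w.vec i) := by
  unfold LocalWord.IsReduced
  by_cases h : (w.rho : ℕ) = 0
  · simp [h]
  · have hk : 1 ≤ k := by have := w.rho.isLt; omega
    have h1 := le_vecVal_iff hk (r := w.vec)
    simp only [pow_one] at h1
    rw [← not_forall, ← h1]
    simp only [ne_eq, h, not_false_eq_true, forall_const]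
    omega

/-- Equivalent reduced entries have the same valuation part. -/
theorem LocalWord.Equiv.rho_eq {a : F} {k l : ℕ} {w w' : LocalWord a k l}
    (hw : w.IsReduced) (hw' : w'.IsReduced) (h : w.Equiv w') : (w.rho : ℕ) = w'.rho := by
  have key : ∀ v v' : LocalWord a k l, v'.IsReduced → v.Equiv v' →
      ¬ (v.rho : ℕ) < v'.rho := by
    intro v v' hv' hvv hlt
    obtain ⟨i, hi⟩ := isReduced_iff.1 hv' (by omega)
    have hle := v'.rho.is_le
    have h1 := hvv i
    obtain ⟨r, hr⟩ := red_surjective a k (v.vec i)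
    obtain ⟨r', hr'⟩ := red_surjective a k (v'.vec i)
    rw [← hr'] at hi
    rw [← pow_one (unif a k), unif_pow_dvd_red (by omega), pow_one] at hi
    rw [← hr, ← hr', unif_pow, unif_pow, ← red_mul, ← red_mul, red_eq_iff] at h1
    apply hi
    obtain ⟨e, he⟩ := Nat.exists_eq_add_of_lt hlt
    have h2 : (X - C a) ^ ((v.rho : ℕ) + 1) ∣
        (X - C a) ^ ((v.rho : ℕ) + e + 1) * r - (X - C a) ^ (v.rho : ℕ) * r' := by
      rw [← he]
      exact (pow_dvd_pow _ (by omega)).trans h1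
    have h3 : (X - C a) ^ ((v.rho : ℕ) + 1) ∣ (X - C a) ^ (v.rho : ℕ) * r' := by
      refine (dvd_sub_right ?_).1 h2
      exact (pow_dvd_pow _ (by omega)).mul_right _
    rw [pow_succ] at h3
    exact (mul_dvd_mul_iff_left (X_sub_C_pow_ne_zero a _)).1 h3
  have h1 := key w w' hw' h
  have h2 := key w' w hw (fun i => (h i).symm)
  omega

/-- At a reduced entry of valuation `ρ`, `(x - a)^ρ` divides the denominator `φ` of every local
solution. -/
theorem LocalWord.IsReduced.pow_dvd {a : F} {k l : ℕ} {w : LocalWord a k l} (hw : w.IsReduced)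
    {φ : F[X]} {ψ : Fin l → F[X]}
    (h : ∀ i, unif a k ^ (w.rho : ℕ) * red a k (ψ i) = red a k φ * w.vec i) :
    (X - C a) ^ (w.rho : ℕ) ∣ φ := by
  by_cases h0 : (w.rho : ℕ) = 0
  · simp [h0]
  obtain ⟨i, hi⟩ := isReduced_iff.1 hw h0
  have hle := w.rho.is_le
  have h1 := h i
  obtain ⟨r, hr⟩ := red_surjective a k (w.vec i)
  rw [← hr] at hi h1
  rw [← pow_one (unif a k), unif_pow_dvd_red (by omega), pow_one,
    ← eval_ne_zero_iff_not_dvd] at hi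
  rw [unif_pow, ← red_mul, ← red_mul, red_eq_iff] at h1
  have h2 := (pow_dvd_pow (X - C a) hle).trans h1
  exact (isCoprime_of_eval_ne_zero hi _).dvd_of_dvd_mul_right
    ((dvd_sub_right (dvd_mul_right _ _)).1 h2)

theorem encode_rho {n l : ℕ} (α : Fin n → F) (lam : Fin n → ℕ) (f : Fin l → F[X]) (g : F[X])
    (j : Fin n) : ((encode α lam f g j).rho : ℕ) = polyVal (α j) (lam j) g := by
  simp only [encode, Fin.val_ofNat]
  exact Nat.mod_eq_of_lt (Nat.lt_succ_of_le (polyVal_le _ _ _))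

/-- At a pole of `f / g` of non-maximal order the encoding does not vanish modulo `x - a`. -/
theorem exists_not_dvd_evVec {l : ℕ} {a : F} {k : ℕ} {f : Fin l → F[X]} {g : F[X]}
    (hfg : CoprimeFamily f g) (h0 : polyVal a k g ≠ 0) (hk : polyVal a k g < k) :
    ∃ i, ¬ unif a k ∣ evVec a k f g i := by
  by_contra! hcon
  obtain ⟨g', -, -, h3⟩ := evVec_spec f hk
  refine not_isUnit_X_sub_C a (hfg (X - C a) ((dvd_pow_self _ h0).trans (pow_polyVal_dvd a k g))
    fun i => ?_)
  rw [← pow_one (X - C a), ← unif_pow_dvd_red (k := k) (by omega), pow_one, ← h3 i]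
  exact (hcon i).mul_left _

theorem encode_isReduced {n l : ℕ} (hl : 0 < l) {α : Fin n → F} {lam : Fin n → ℕ}
    {f : Fin l → F[X]} {g : F[X]} (hfg : CoprimeFamily f g) (j : Fin n) :
    (encode α lam f g j).IsReduced := by
  rw [isReduced_iff, encode_rho]
  intro h0
  rcases (polyVal_le (α j) (lam j) g).lt_or_eq with h | h
  · exact exists_not_dvd_evVec hfg h0 h
  · refine ⟨⟨0, hl⟩, ?_⟩
    simp only [encode, evVec, if_pos h]
    rw [show (1 : LocalRing (α j) (lam j)) = red _ _ 1 from (map_one _).symm,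
      ← pow_one (unif _ _), unif_pow_dvd_red (by omega), pow_one, ← eval_ne_zero_iff_not_dvd]
    simp

/-! ### The decoder on words whose solutions are all proportional to `(g, f)` -/

theorem CoprimeFamily.exists_bezout {l : ℕ} {f : Fin l → F[X]} {g : F[X]}
    (h : CoprimeFamily f g) : ∃ (a : F[X]) (b : Fin l → F[X]), a * g + ∑ i, b i * f i = 1 := by
  obtain ⟨d, hd⟩ := IsPrincipalIdealRing.principal
    (Ideal.span {g} ⊔ Ideal.span (Set.range f))
  have hmem : ∀ x ∈ Ideal.span {g} ⊔ Ideal.span (Set.range f), d ∣ x := fun x hx => by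
    rw [hd] at hx
    exact Ideal.mem_span_singleton.1 hx
  have hu : IsUnit d := h d
    (hmem _ (Ideal.mem_sup_left (Ideal.mem_span_singleton_self g)))
    fun i => hmem _ (Ideal.mem_sup_right (Ideal.subset_span ⟨i, rfl⟩))
  have h1 : (1 : F[X]) ∈ Ideal.span {g} ⊔ Ideal.span (Set.range f) := by
    rw [hd]
    exact Ideal.mem_span_singleton.2 hu.dvd
  obtain ⟨x, hx, y, hy, hxy⟩ := Submodule.mem_sup.1 h1
  obtain ⟨a, rfl⟩ := Ideal.mem_span_singleton'.1 hx
  obtain ⟨b, rfl⟩ := Ideal.mem_span_range_iff_exists_fun.1 hy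
  exact ⟨a, b, hxy⟩

theorem CoprimeFamily.dvd_of_dvd_mul {l : ℕ} {f : Fin l → F[X]} {g : F[X]}
    (h : CoprimeFamily f g) {d e : F[X]} (hg : d ∣ e * g) (hf : ∀ i, d ∣ e * f i) : d ∣ e := by
  obtain ⟨a, b, hab⟩ := h.exists_bezout
  have : e = a * (e * g) + ∑ i, b i * (e * f i) := by
    calc e = e * (a * g + ∑ i, b i * f i) := by rw [hab, mul_one]
      _ = _ := by
        rw [mul_add, Finset.mul_sum]
        congr 1
        · ring
        · exact Finset.sum_congr rfl fun i _ => by ring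
  rw [this]
  exact dvd_add (hg.mul_left _) (Finset.dvd_sum fun i _ => (hf i).mul_left _)

theorem CoprimeFamily.exists_eq_mul {l : ℕ} {f : Fin l → F[X]} {g : F[X]}
    (h : CoprimeFamily f g) (hg : g ≠ 0) {φ : F[X]} {ψ : Fin l → F[X]}
    (hψ : ∀ i, g * ψ i = f i * φ) : ∃ e, φ = e * g ∧ ∀ i, ψ i = e * f i := by
  obtain ⟨e, rfl⟩ : g ∣ φ := h.dvd_of_dvd_mul (dvd_mul_left _ _) fun i =>
    ⟨ψ i, by rw [hψ i, mul_comm]⟩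
  refine ⟨e, mul_comm _ _, fun i => mul_left_cancel₀ hg ?_⟩
  rw [hψ i]
  ring

theorem maxDegree_mul_lt {l : ℕ} {f : Fin l → F[X]} {g : F[X]} (hg : g ≠ 0) {e d : F[X]}
    (h : d.degree < e.degree) :
    maxDegree (d * g) (fun i => d * f i) < maxDegree (e * g) (fun i => e * f i) := by
  have he : e ≠ 0 := by
    rintro rfl
    simp at h
  have key : ∀ p : F[X], p ≠ 0 → (d * p).degree < (e * p).degree := fun p hp => by
    rw [degree_mul, degree_mul, degree_eq_natDegree hp]
    exact WithBot.add_lt_add_right WithBot.coe_ne_bot h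
  have hbot : ⊥ < maxDegree (e * g) (fun i => e * f i) :=
    lt_of_lt_of_le (bot_lt_iff_ne_bot.2 (degree_ne_bot.2 (mul_ne_zero he hg)))
      (le_max_left _ _)
  refine max_lt ((key g hg).trans_le (le_max_left _ _)) ?_
  rw [Finset.sup_lt_iff hbot]
  intro i _
  rcases eq_or_ne (f i) 0 with h0 | h0
  · simpa [h0] using hbot
  · refine (key _ h0).trans_le (le_max_of_le_right ?_)
    exact Finset.le_sup (f := fun i => (e * f i).degree) (Finset.mem_univ i)

/-- If some multiple `(Λ g, Λ f)` with `deg Λ ≤ t` is a solution and all the solutions are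
multiples of `(g, f)`, then a solution of minimal degree is `(e g, e f)` with `deg e ≤ deg Λ`, so
that the decoder passes its degree tests and returns `f / g`. -/
theorem decodesTo_of_forall_isSolution {n l : ℕ} {α : Fin n → F} {lam : Fin n → ℕ}
    {df dg t : ℕ} {R : Word α lam l} {f : Fin l → F[X]} {g Λ : F[X]} (hg : g ≠ 0)
    (hfg : CoprimeFamily f g)
    (hf_deg : ∀ i, (f i).degree < (df : WithBot ℕ)) (hg_deg : g.degree < (dg : WithBot ℕ))
    (hΛ : Λ ≠ 0) (hΛt : Λ.degree ≤ (t : WithBot ℕ))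
    (hsol : IsSolution df dg t R (Λ * g) (fun i => Λ * f i))
    (hall : ∀ φ ψ, IsSolution df dg t R φ ψ → ∀ i, g * ψ i = f i * φ) :
    DecodesTo df dg t R f g := by
  classical
  have hform : ∀ φ ψ, IsMinimalSolution df dg t R φ ψ →
      ∃ e, e ≠ 0 ∧ e.degree ≤ (t : WithBot ℕ) ∧ φ = e * g ∧ ∀ i, ψ i = e * f i := by
    rintro φ ψ ⟨h1, h2, h3⟩
    obtain ⟨e, he, he'⟩ := hfg.exists_eq_mul hg (hall φ ψ h1)
    obtain rfl : ψ = fun i => e * f i := funext he'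
    subst he
    refine ⟨e, ?_, ?_, rfl, fun _ => rfl⟩
    · rintro rfl
      exact h2 ⟨by simp, by ext; simp⟩
    · refine le_trans ?_ hΛt
      by_contra! hlt
      refine absurd (h3 _ _ hsol fun h => mul_ne_zero hΛ hg h.1) (not_le.2 ?_)
      exact maxDegree_mul_lt hg hlt
  constructor
  · let S : Set (F[X] × (Fin l → F[X])) :=
      {x | IsSolution df dg t R x.1 x.2 ∧ ¬ (x.1 = 0 ∧ x.2 = 0)}
    have hS : S.Nonempty := ⟨(Λ * g, fun i => Λ * f i), hsol, fun h => mul_ne_zero hΛ hg h.1⟩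
    obtain ⟨x, hx, hmin⟩ := (InvImage.wf (fun x : F[X] × (Fin l → F[X]) => maxDegree x.1 x.2)
      (wellFounded_lt (α := WithBot ℕ))).has_min S hS
    have hmin' : IsMinimalSolution df dg t R x.1 x.2 :=
      ⟨hx.1, hx.2, fun φ₁ ψ₁ h h' => not_lt.1 (hmin (φ₁, ψ₁) ⟨h, h'⟩)⟩
    obtain ⟨e, -, -, h1, h2⟩ := hform _ _ hmin'
    refine ⟨_, x.1, x.2, e, g, f, hmin', ⟨⟨⟨g, h1⟩, fun i => ⟨f i, h2 i⟩⟩, ?_⟩, h1, h2, rfl⟩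
    intro d hd hd'
    exact hfg.dvd_of_dvd_mul (h1 ▸ hd) fun i => h2 i ▸ hd' i
  · rintro _ ⟨φ, ψ, η, φ', ψ', hmin, ⟨⟨hη1, hη2⟩, hη⟩, hφ, hψ, rfl⟩
    obtain ⟨e, he0, hedeg, h1, h2⟩ := hform _ _ hmin
    have hηe : η ∣ e := hfg.dvd_of_dvd_mul (h1 ▸ hη1) fun i => h2 i ▸ hη2 i
    have heη : e ∣ η := hη e ⟨g, h1⟩ fun i => ⟨f i, h2 i⟩
    obtain ⟨c, rfl⟩ := associated_of_dvd_dvd heη hηe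
    have hφ' : c * φ' = g := mul_left_cancel₀ he0 (by rw [← mul_assoc, ← hφ, h1])
    have hψ' : ∀ i, c * ψ' i = f i := fun i =>
      mul_left_cancel₀ he0 (by rw [← mul_assoc, ← hψ, h2])
    have hc : (c : F[X]).degree = 0 := degree_coe_units c
    rw [if_pos]
    · refine ⟨φ', ψ', rfl, ?_, fun i => ?_⟩
      · rintro rfl
        exact hg (by rw [← hφ', mul_zero])
      · rw [← hφ', ← hψ']
        ring
    · refine ⟨?_, ?_, fun i => ?_⟩
      · rwa [degree_mul, hc, add_zero]
      · rwa [← hφ', degree_mul, hc, zero_add] at hg_deg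
      · have := hf_deg i
        rwa [← hψ', degree_mul, hc, zero_add] at this

/-! ### Key equations at a single evaluation point -/

theorem unif_pow_self (a : F) (k : ℕ) : unif a k ^ k = 0 := by
  rw [unif_pow, show (0 : LocalRing a k) = red a k 0 from (map_zero _).symm, red_eq_iff, sub_zero]

theorem red_eq_zero_iff {a : F} {k : ℕ} {p : F[X]} : red a k p = 0 ↔ (X - C a) ^ k ∣ p := by
  rw [show (0 : LocalRing a k) = red a k 0 from (map_zero _).symm, red_eq_iff, sub_zero]

theorem unif_pow_eq_zero {a : F} {k s : ℕ} (h : k ≤ s) : unif a k ^ s = 0 := by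
  rw [unif_pow, red_eq_zero_iff]
  exact pow_dvd_pow _ h

/-- An entry equivalent to the encoding satisfies the key equation for `(g, f)`. -/
theorem key_equation_of_equiv {l : ℕ} {a : F} {k : ℕ} {f : Fin l → F[X]} {g : F[X]}
    {w : LocalWord a k l} (hρ : (w.rho : ℕ) = polyVal a k g)
    (h : ∀ i, unif a k ^ polyVal a k g * w.vec i = unif a k ^ polyVal a k g * evVec a k f g i)
    (i : Fin l) : unif a k ^ (w.rho : ℕ) * red a k (f i) = red a k g * w.vec i := by
  rw [hρ]
  rcases (polyVal_le a k g).lt_or_eq with hk | hk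
  · obtain ⟨g', h1, -, h3⟩ := evVec_spec f hk
    have h4 : red a k g = unif a k ^ polyVal a k g * red a k g' := by
      rw [unif_pow, ← red_mul, ← h1]
    rw [h4, ← h3 i]
    linear_combination (-red a k g') * h i
  · have h0 : red a k g = 0 := by
      rw [red_eq_zero_iff]
      conv_lhs => rw [← hk]
      exact pow_polyVal_dvd a k g
    rw [hk, unif_pow_self, h0, zero_mul, zero_mul]

/-- At an entry equivalent to the encoding, every solution is proportional to `(g, f)` modulo
`(x - a)^k`. -/
theorem dvd_of_equiv {l : ℕ} {a : F} {k : ℕ} {f : Fin l → F[X]} {g : F[X]}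
    {w : LocalWord a k l} (hw : w.IsReduced) (hρ : (w.rho : ℕ) = polyVal a k g)
    (h : ∀ i, unif a k ^ polyVal a k g * w.vec i = unif a k ^ polyVal a k g * evVec a k f g i)
    {φ : F[X]} {ψ : Fin l → F[X]}
    (hsol : ∀ i, unif a k ^ (w.rho : ℕ) * red a k (ψ i) = red a k φ * w.vec i) (i : Fin l) :
    (X - C a) ^ k ∣ g * ψ i - f i * φ := by
  have hφ := hw.pow_dvd hsol
  rw [hρ] at hφ
  rcases (polyVal_le a k g).lt_or_eq with hk | hk
  · obtain ⟨g', h1, -, h3⟩ := evVec_spec f hk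
    obtain ⟨φ₁, hφ₁⟩ := hφ
    have h4 : red a k g = unif a k ^ polyVal a k g * red a k g' := by
      rw [unif_pow, ← red_mul, ← h1]
    have h5 : red a k φ = unif a k ^ polyVal a k g * red a k φ₁ := by
      rw [unif_pow, ← red_mul, ← hφ₁]
    have h6 := hsol i
    rw [hρ] at h6
    rw [← red_eq_iff, red_mul, red_mul, h4, ← h3 i]
    linear_combination red a k g' * h6 + red a k g' * w.vec i * h5 +
      red a k g' * red a k φ₁ * h i - red a k g' * evVec a k f g i * h5
  · have h1 : (X - C a) ^ k ∣ g := by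
      conv_lhs => rw [← hk]
      exact pow_polyVal_dvd a k g
    rw [hk] at hφ
    exact dvd_sub (h1.mul_right _) (hφ.mul_left _)

/-- The constraint put on an entry `r` at an evaluation error by the existence of a solution
`(φ, ψ)` with `g ψ - f φ = Y p`, where `Y = ∏ (x - α_j)^μ_j`: if `r = S + (x - a)^(μ - ν) e`, then
`p = χ e` modulo `(x - a)^(k - μ)`. -/
def ErrorRel {l : ℕ} {a : F} {k : ℕ} (ν μ : ℕ) (S : Fin l → LocalRing a k) (p : Fin l → F[X])
    (χ : F[X]) (r : Fin l → LocalRing a k) : Prop :=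
  ∀ i, unif a k ^ μ * red a k (p i) = unif a k ^ ν * red a k χ * (r i - S i)

/-- At an evaluation error, the key equation for `(Λ g, Λ f)` holds as soon as `Λ` is divisible
by the local factor of the error locator. -/
theorem key_equation_of_evaluation_error {l : ℕ} {a : F} {k μ : ℕ} {f : Fin l → F[X]}
    {g Λ : F[X]} {w : LocalWord a k l} (hρ : (w.rho : ℕ) = polyVal a k g)
    (hνμ : polyVal a k g ≤ μ) (hμ : μ < k)
    (hw : μ - polyVal a k g ≤ vecVal fun i => w.vec i - evVec a k f g i)
    (hΛ : (X - C a) ^ (k - μ) ∣ Λ) (i : Fin l) :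
    unif a k ^ (w.rho : ℕ) * red a k (Λ * f i) = red a k (Λ * g) * w.vec i := by
  obtain ⟨g', h1, -, h3⟩ := evVec_spec f (hνμ.trans_lt hμ)
  obtain ⟨e, he⟩ := pow_dvd_of_le_vecVal hw i
  obtain ⟨Λ', hΛ'⟩ := hΛ
  have h4 : red a k g = unif a k ^ polyVal a k g * red a k g' := by
    rw [unif_pow, ← red_mul, ← h1]
  have h5 : red a k Λ = unif a k ^ (k - μ) * red a k Λ' := by
    rw [unif_pow, ← red_mul, ← hΛ']
  have h6 : unif a k ^ (k - μ) * unif a k ^ polyVal a k g *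
      unif a k ^ (μ - polyVal a k g) = 0 := by
    rw [← pow_add, ← pow_add]
    exact unif_pow_eq_zero (by omega)
  rw [hρ, red_mul, red_mul, h4, ← h3 i, h5]
  linear_combination (-unif a k ^ (k - μ) * red a k Λ' * unif a k ^ polyVal a k g * red a k g') * he
    - red a k Λ' * red a k g' * e * h6

/-- At an evaluation error, `g ψ - f φ` is still divisible by `(x - a)^μ`, and its reduction is a
multiple of the error. -/
theorem evaluation_error_of_solution {l : ℕ} {a : F} {k μ : ℕ} {f : Fin l → F[X]}
    {g : F[X]} {w : LocalWord a k l} (hr : w.IsReduced) (hρ : (w.rho : ℕ) = polyVal a k g)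
    (hνμ : polyVal a k g ≤ μ) (hμ : μ < k)
    (hw : μ - polyVal a k g ≤ vecVal fun i => w.vec i - evVec a k f g i)
    {φ : F[X]} {ψ : Fin l → F[X]}
    (hsol : ∀ i, unif a k ^ (w.rho : ℕ) * red a k (ψ i) = red a k φ * w.vec i) :
    (∀ i, (X - C a) ^ μ ∣ g * ψ i - f i * φ) ∧
    ∃ ζ : F[X], ∀ i, red a k (g * ψ i - f i * φ) =
      unif a k ^ polyVal a k g * red a k ζ * (w.vec i - evVec a k f g i) := by
  obtain ⟨g', h1, -, h3⟩ := evVec_spec f (hνμ.trans_lt hμ)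
  obtain ⟨φ₁, hφ₁⟩ := hr.pow_dvd hsol
  rw [hρ] at hφ₁
  have h4 : red a k g = unif a k ^ polyVal a k g * red a k g' := by
    rw [unif_pow, ← red_mul, ← h1]
  have h5 : red a k φ = unif a k ^ polyVal a k g * red a k φ₁ := by
    rw [unif_pow, ← red_mul, ← hφ₁]
  have key : ∀ i, red a k (g * ψ i - f i * φ) =
      unif a k ^ polyVal a k g * red a k (g' * φ₁) * (w.vec i - evVec a k f g i) := by
    intro i
    have h6 := hsol i
    rw [hρ] at h6
    rw [red_sub, red_mul, red_mul, red_mul, h4, ← h3 i]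
    linear_combination red a k g' * h6 + red a k g' * (w.vec i - evVec a k f g i) * h5
  refine ⟨fun i => ?_, _, key⟩
  rw [← unif_pow_dvd_red hμ.le, key i]
  obtain ⟨e, he⟩ := pow_dvd_of_le_vecVal hw i
  rw [he]
  refine ⟨red a k (g' * φ₁) * e, ?_⟩
  conv_rhs => rw [show μ = polyVal a k g + (μ - polyVal a k g) by omega, pow_add]
  ring

/-- Dividing `Y (x - a)^μ p = (x - a)^ν ζ (r - S)` by the unit `Y` modulo `(x - a)^k`. The
multiplier only matters modulo `(x - a)^(k - μ)`, as `r - S` is divisible by `(x - a)^(μ - ν)`. -/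
theorem exists_errorRel {l : ℕ} {a : F} {k ν μ : ℕ} (hνμ : ν ≤ μ) (hμ : μ < k)
    {S r : Fin l → LocalRing a k} (hr : ∀ i, unif a k ^ (μ - ν) ∣ r i - S i)
    {Y ζ : F[X]} {p : Fin l → F[X]} (hY : Y.eval a ≠ 0)
    (h : ∀ i, red a k ((X - C a) ^ μ * Y * p i) = unif a k ^ ν * red a k ζ * (r i - S i)) :
    ∃ χ : F[X], χ.degree < ((k - μ : ℕ) : WithBot ℕ) ∧ ErrorRel ν μ S p χ r := by
  obtain ⟨z, hz⟩ := (isUnit_red (k := k) hY).exists_left_inv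
  obtain ⟨z, rfl⟩ := red_surjective a k z
  have hm : ((X - C a) ^ (k - μ)).Monic := (monic_X_sub_C a).pow _
  refine ⟨(z * ζ) %ₘ (X - C a) ^ (k - μ), ?_, fun i => ?_⟩
  · have := degree_modByMonic_lt (z * ζ) hm
    rwa [degree_pow, degree_X_sub_C, nsmul_one] at this
  · have h1 := modByMonic_add_div (z * ζ) ((X - C a) ^ (k - μ))
    have h2 : red a k z * red a k ζ = red a k ((z * ζ) %ₘ (X - C a) ^ (k - μ)) +
        unif a k ^ (k - μ) * red a k ((z * ζ) /ₘ (X - C a) ^ (k - μ)) := by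
      rw [unif_pow, ← red_mul, ← red_mul, ← red_add, h1]
    obtain ⟨e, he⟩ := hr i
    have h3 : unif a k ^ ν * unif a k ^ (k - μ) * unif a k ^ (μ - ν) = 0 := by
      rw [← pow_add, ← pow_add]
      exact unif_pow_eq_zero (by omega)
    have h4 := h i
    rw [red_mul, red_mul, ← unif_pow] at h4
    linear_combination (-unif a k ^ μ * red a k (p i)) * hz + red a k z * h4 +
      unif a k ^ ν * (r i - S i) * h2 +
      unif a k ^ ν * unif a k ^ (k - μ) * red a k ((z * ζ) /ₘ (X - C a) ^ (k - μ)) * he +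
      e * red a k ((z * ζ) /ₘ (X - C a) ^ (k - μ)) * h3

/-! ### Words on which the decoder fails -/

theorem locator_monic {n : ℕ} (α : Fin n → F) (lam μ : Fin n → ℕ) (s : Finset (Fin n)) :
    (locator α lam μ s).Monic :=
  monic_prod_of_monic _ _ fun j _ => (monic_X_sub_C (α j)).pow _

theorem natDegree_prod_X_sub_C_pow {n : ℕ} (α : Fin n → F) (m : Fin n → ℕ) (s : Finset (Fin n)) :
    (∏ j ∈ s, (X - C (α j)) ^ m j).natDegree = ∑ j ∈ s, m j := by
  rw [natDegree_prod_of_monic _ _ fun j _ => (monic_X_sub_C (α j)).pow _]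
  simp

theorem natDegree_locator {n : ℕ} (α : Fin n → F) (lam μ : Fin n → ℕ) (s : Finset (Fin n)) :
    (locator α lam μ s).natDegree = ∑ j ∈ s, (lam j - μ j) :=
  natDegree_prod_X_sub_C_pow _ _ _

theorem prod_X_sub_C_pow_dvd {n : ℕ} {α : Fin n → F} (hα : Function.Injective α) {m : Fin n → ℕ}
    {s : Finset (Fin n)} {p : F[X]} (h : ∀ j ∈ s, (X - C (α j)) ^ m j ∣ p) :
    ∏ j ∈ s, (X - C (α j)) ^ m j ∣ p := by
  refine Finset.prod_dvd_of_coprime (fun i _ j _ hij => ?_) h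
  exact (pairwise_coprime_X_sub_C hα hij).pow

theorem pow_dvd_locator {n : ℕ} (α : Fin n → F) (lam μ : Fin n → ℕ) {s : Finset (Fin n)}
    {j : Fin n} (hj : j ∈ s) : (X - C (α j)) ^ (lam j - μ j) ∣ locator α lam μ s :=
  Finset.dvd_prod_of_mem (fun j => (X - C (α j)) ^ (lam j - μ j)) hj

theorem eval_prod_X_sub_C_pow_ne_zero {n : ℕ} {α : Fin n → F} (hα : Function.Injective α)
    {m : Fin n → ℕ} {s : Finset (Fin n)} {j : Fin n} (hj : j ∉ s) :
    (∏ i ∈ s, (X - C (α i)) ^ m i).eval (α j) ≠ 0 := by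
  rw [eval_prod, Finset.prod_ne_zero_iff]
  intro i hi
  rw [eval_pow, eval_sub, eval_X, eval_C]
  refine pow_ne_zero _ (sub_ne_zero.2 fun h => hj ?_)
  rwa [hα h]

section

variable {n l : ℕ} {α : Fin n → F} {lam : Fin n → ℕ} {f : Fin l → F[X]} {g : F[X]}
  {ξe ξv : Finset (Fin n)} {μ : Fin n → ℕ} {W : Word α lam l}

theorem IsErrorPattern.mu_le (hW : IsErrorPattern g ξe ξv μ W) (j : Fin n) : μ j ≤ lam j := by
  by_cases he : j ∈ ξe
  · exact (hW.mu_of_mem_e j he).2.le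
  by_cases hv : j ∈ ξv
  · exact (hW.mu_of_mem_v j hv).2.le
  · exact (hW.mu_of_not_mem j he hv).le

theorem errorModel_correct (hl : 0 < l) (hfg : CoprimeFamily f g) {R : Word α lam l}
    (hR : R ∈ errorModel f g ξe ξv μ W) {j : Fin n} (he : j ∉ ξe) (hv : j ∉ ξv) :
    ((R j).rho : ℕ) = polyVal (α j) (lam j) g ∧
      ∀ i, unif (α j) (lam j) ^ polyVal (α j) (lam j) g * (R j).vec i =
        unif (α j) (lam j) ^ polyVal (α j) (lam j) g * evVec (α j) (lam j) f g i := by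
  have h1 := hR.2.1 j he hv
  have h2 := h1.rho_eq (hR.1 j) (encode_isReduced hl hfg j)
  rw [encode_rho] at h2
  refine ⟨h2, fun i => ?_⟩
  have h3 := h1 i
  rw [encode_rho, h2] at h3
  exact h3

theorem errorModel_valuation (hW : IsErrorPattern g ξe ξv μ W) {R : Word α lam l}
    (hR : R ∈ errorModel f g ξe ξv μ W) {j : Fin n} (hv : j ∈ ξv) :
    μ j ≤ (R j).rho := by
  rw [(hR.2.2.1 j hv).rho_eq (hR.1 j) (hW.reduced j hv)]
  rcases (hW.mu_of_mem_v j hv).1.lt_or_eq with h | h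
  · exact (hW.rho_of_lt j hv h).ge
  · exact h.le.trans (hW.rho_of_eq j hv h).le

theorem isSolution_locator (hl : 0 < l) (hfg : CoprimeFamily f g)
    (hW : IsErrorPattern g ξe ξv μ W) {R : Word α lam l}
    (hR : R ∈ errorModel f g ξe ξv μ W) {df dg tv te : ℕ}
    (hf_deg : ∀ i, (f i).degree < (df : WithBot ℕ)) (hg_deg : g.degree < (dg : WithBot ℕ))
    (hv_deg : (locator α lam μ ξv).natDegree ≤ tv)
    (he_deg : (locator α lam μ ξe).natDegree ≤ te) :
    IsSolution df dg (tv + te) R (locator α lam μ ξv * locator α lam μ ξe * g)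
      (fun i => locator α lam μ ξv * locator α lam μ ξe * f i) := by
  have hdeg : ∀ (p : F[X]) (N : ℕ), p.degree < (N : WithBot ℕ) →
      (locator α lam μ ξv * locator α lam μ ξe * p).degree < ((N + (tv + te) : ℕ) : WithBot ℕ) := by
    intro p N hp
    rcases eq_or_ne p 0 with rfl | h0
    · rw [mul_zero, degree_zero]
      exact WithBot.bot_lt_coe _
    · have hv := locator_monic α lam μ ξv
      have he := locator_monic α lam μ ξe
      rw [← natDegree_lt_iff_degree_lt h0] at hp
      rw [← natDegree_lt_iff_degree_lt (mul_ne_zero (mul_ne_zero hv.ne_zero he.ne_zero) h0),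
        natDegree_mul (mul_ne_zero hv.ne_zero he.ne_zero) h0,
        natDegree_mul hv.ne_zero he.ne_zero]
      omega
  refine ⟨fun i j => ?_, hdeg g dg hg_deg, fun i => hdeg (f i) df (hf_deg i)⟩
  by_cases he : j ∈ ξe
  · obtain ⟨h1, h2⟩ := hR.2.2.2 j he
    exact key_equation_of_evaluation_error h1 (hW.mu_of_mem_e j he).1 (hW.mu_of_mem_e j he).2 h2
      ((pow_dvd_locator α lam μ he).mul_left _) i
  by_cases hv : j ∈ ξv
  · have hρ := errorModel_valuation hW hR hv
    have hle := hW.mu_le j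
    have hΛ : (X - C (α j)) ^ (lam j - μ j) ∣ locator α lam μ ξv * locator α lam μ ξe :=
      (pow_dvd_locator α lam μ hv).mul_right _
    have h1 : red (α j) (lam j) (locator α lam μ ξv * locator α lam μ ξe * g) = 0 := by
      rw [red_eq_zero_iff, show lam j = (lam j - μ j) + μ j by omega, pow_add]
      exact mul_dvd_mul hΛ
        ((pow_dvd_pow _ (hW.mu_of_mem_v j hv).1).trans (pow_polyVal_dvd _ _ g))
    rw [h1, zero_mul, unif_pow, ← red_mul, red_eq_zero_iff]
    refine (pow_dvd_pow (X - C (α j))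
      (show lam j ≤ ((R j).rho : ℕ) + (lam j - (R j).rho) by omega)).trans ?_
    rw [pow_add]
    exact mul_dvd_mul_left _ (((pow_dvd_pow _ (by omega)).trans hΛ).mul_right _)
  · obtain ⟨h1, h2⟩ := errorModel_correct hl hfg hR he hv
    have h3 := key_equation_of_equiv h1 h2 i
    beta_reduce
    rw [red_mul _ _ _ (f i), red_mul _ _ _ g]
    linear_combination red (α j) (lam j) (locator α lam μ ξv * locator α lam μ ξe) * h3

/-- On a word of the error model, `g ψ - f φ` is divisible by `∏ (x - α_j)^μ_j` for every solution
`(φ, ψ)`. -/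
theorem prod_dvd_of_isSolution (hl : 0 < l) (hα : Function.Injective α)
    (hfg : CoprimeFamily f g)
    (hW : IsErrorPattern g ξe ξv μ W) {R : Word α lam l}
    (hR : R ∈ errorModel f g ξe ξv μ W) {df dg t : ℕ} {φ : F[X]} {ψ : Fin l → F[X]}
    (hsol : IsSolution df dg t R φ ψ) (i : Fin l) :
    ∏ j, (X - C (α j)) ^ μ j ∣ g * ψ i - f i * φ := by
  refine prod_X_sub_C_pow_dvd hα fun j _ => ?_
  by_cases he : j ∈ ξe
  · obtain ⟨h1, h2⟩ := hR.2.2.2 j he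
    exact (evaluation_error_of_solution (hR.1 j) h1 (hW.mu_of_mem_e j he).1
      (hW.mu_of_mem_e j he).2 h2 fun i => hsol.1 i j).1 i
  by_cases hv : j ∈ ξv
  · have hφ := (hR.1 j).pow_dvd fun i => hsol.1 i j
    have hg := (pow_dvd_pow (X - C (α j)) (hW.mu_of_mem_v j hv).1).trans (pow_polyVal_dvd _ _ g)
    exact dvd_sub (hg.mul_right _)
      (((pow_dvd_pow _ (errorModel_valuation hW hR hv)).trans hφ).mul_left _)
  · obtain ⟨h1, h2⟩ := errorModel_correct hl hfg hR he hv
    rw [hW.mu_of_not_mem j he hv]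
    exact dvd_of_equiv (hR.1 j) h1 h2 (fun i => hsol.1 i j) i

theorem sum_mu (hW : IsErrorPattern g ξe ξv μ W) :
    ∑ j, lam j = ∑ j, μ j + (locator α lam μ ξv).natDegree + (locator α lam μ ξe).natDegree := by
  rw [natDegree_locator, natDegree_locator, add_assoc, add_comm (∑ j ∈ ξv, _),
    ← Finset.sum_union hW.disjoint, Finset.sum_subset (Finset.subset_univ (ξe ∪ ξv)),
    ← Finset.sum_add_distrib]
  · refine Finset.sum_congr rfl fun j _ => ?_
    have := hW.mu_le j
    omega
  · intro j _ hj
    rw [Finset.mem_union, not_or] at hj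
    rw [hW.mu_of_not_mem j hj.1 hj.2, Nat.sub_self]

/-- If the decoder fails on a word `R` of the error model, then the errors satisfy nontrivial
linear relations: `p = χ_j e_j` modulo `(x - α_j)^(λ_j - μ_j)` for a nonzero vector `p` of small
degree. Namely `p = (g ψ - f φ) / ∏ (x - α_j)^μ_j` for a solution `(φ, ψ)` that is not
proportional to `(g, f)`. -/
theorem exists_errorRel_of_not_decodesTo (hl : 0 < l) (hα : Function.Injective α)
    (hg : g ≠ 0) (hfg : CoprimeFamily f g)
    (hW : IsErrorPattern g ξe ξv μ W) {R : Word α lam l}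
    (hR : R ∈ errorModel f g ξe ξv μ W) {df dg tv te A : ℕ}
    (hA : ∑ j, lam j + 1 = df + dg + 2 * tv + A)
    (hf_deg : ∀ i, (f i).degree < (df : WithBot ℕ)) (hg_deg : g.degree < (dg : WithBot ℕ))
    (hv_deg : (locator α lam μ ξv).natDegree ≤ tv)
    (he_deg : (locator α lam μ ξe).natDegree ≤ te)
    (hfail : ¬ DecodesTo df dg (tv + te) R f g) :
    ∃ (p : Fin l → F[X]) (χ : Fin n → F[X]), p ≠ 0 ∧
      (∀ i, (p i).degree <
        ((te + (locator α lam μ ξe).natDegree - A : ℕ) : WithBot ℕ)) ∧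
      ∀ j ∈ ξe, (χ j).degree < ((lam j - μ j : ℕ) : WithBot ℕ) ∧
        ErrorRel (polyVal (α j) (lam j) g) (μ j) (evVec (α j) (lam j) f g) p (χ j)
          (R j).vec := by
  have hv := locator_monic α lam μ ξv
  have he := locator_monic α lam μ ξe
  have hne : ∃ φ ψ, IsSolution df dg (tv + te) R φ ψ ∧ ∃ i, g * ψ i ≠ f i * φ := by
    by_contra! hcon
    refine hfail (decodesTo_of_forall_isSolution hg hfg hf_deg hg_deg
      (mul_ne_zero hv.ne_zero he.ne_zero) ?_
      (isSolution_locator hl hfg hW hR hf_deg hg_deg hv_deg he_deg) hcon)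
    rw [← natDegree_le_iff_degree_le, natDegree_mul hv.ne_zero he.ne_zero]
    omega
  obtain ⟨φ, ψ, hsol, i₀, hi₀⟩ := hne
  choose p hp using prod_dvd_of_isSolution hl hα hfg hW hR hsol
  have hY : (∏ j, (X - C (α j)) ^ μ j) ≠ 0 :=
    Finset.prod_ne_zero_iff.2 fun j _ => X_sub_C_pow_ne_zero _ _
  have hχ : ∀ j, ∃ χ : F[X], j ∈ ξe → χ.degree < ((lam j - μ j : ℕ) : WithBot ℕ) ∧
      ErrorRel (polyVal (α j) (lam j) g) (μ j) (evVec (α j) (lam j) f g) p χ (R j).vec := by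
    intro j
    by_cases hj : j ∈ ξe
    · obtain ⟨h1, h2⟩ := hR.2.2.2 j hj
      obtain ⟨-, ζ, hζ⟩ := evaluation_error_of_solution (hR.1 j) h1 (hW.mu_of_mem_e j hj).1
        (hW.mu_of_mem_e j hj).2 h2 fun i => hsol.1 i j
      obtain ⟨χ, hχ⟩ := exists_errorRel (hW.mu_of_mem_e j hj).1
        (hW.mu_of_mem_e j hj).2 (fun i => pow_dvd_of_le_vecVal h2 i) (p := p) (ζ := ζ)
        (eval_prod_X_sub_C_pow_ne_zero hα (m := μ) (Finset.notMem_erase j Finset.univ))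
        (fun i => by
          rw [Finset.mul_prod_erase Finset.univ (fun j => (X - C (α j)) ^ μ j)
            (Finset.mem_univ j), ← hp i]
          exact hζ i)
      exact ⟨χ, fun _ => hχ⟩
    · exact ⟨0, fun h => absurd h hj⟩
  choose χ hχ using hχ
  refine ⟨p, χ, ?_, fun i => ?_, hχ⟩
  · rintro rfl
    refine hi₀ (sub_eq_zero.1 ?_)
    rw [hp i₀, Pi.zero_apply, mul_zero]
  · rcases eq_or_ne (p i) 0 with h0 | h0
    · rw [h0, degree_zero]
      exact WithBot.bot_lt_coe _
    · have hsum := sum_mu (α := α) hW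
      have h1 : g * ψ i - f i * φ ≠ 0 := by
        rw [hp i]
        exact mul_ne_zero hY h0
      have h2 : (g * ψ i - f i * φ).natDegree + 1 < df + dg + (tv + te) := by
        have hb : ∀ {q r : F[X]} {M N : ℕ}, q.degree < (M : WithBot ℕ) →
            r.degree < ((N + (tv + te) : ℕ) : WithBot ℕ) → q ≠ 0 →
            (q * r).degree < ((M + N + (tv + te) - 1 : ℕ) : WithBot ℕ) := by
          intro q r M N hq hr hq0
          rcases eq_or_ne r 0 with rfl | hr0
          · rw [mul_zero, degree_zero]
            exact WithBot.bot_lt_coe _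
          · rw [← natDegree_lt_iff_degree_lt hq0] at hq
            rw [← natDegree_lt_iff_degree_lt hr0] at hr
            rw [← natDegree_lt_iff_degree_lt (mul_ne_zero hq0 hr0), natDegree_mul hq0 hr0]
            omega
        have h3 : (g * ψ i).degree < ((df + dg + (tv + te) - 1 : ℕ) : WithBot ℕ) := by
          rw [add_comm df dg]
          exact hb hg_deg (hsol.2.2 i) hg
        have h4 : (f i * φ).degree < ((df + dg + (tv + te) - 1 : ℕ) : WithBot ℕ) := by
          rcases eq_or_ne (f i) 0 with hf0 | hf0
          · rw [hf0, zero_mul, degree_zero]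
            exact WithBot.bot_lt_coe _
          · exact hb (hf_deg i) hsol.2.1 hf0
        have h5 := (degree_sub_le (g * ψ i) (f i * φ)).trans_lt (max_lt h3 h4)
        rw [← natDegree_lt_iff_degree_lt h1] at h5
        omega
      rw [hp i, natDegree_mul hY h0, natDegree_prod_X_sub_C_pow] at h2
      rw [← natDegree_lt_iff_degree_lt h0]
      omega

end

/-! ### Counting local errors -/

theorem finite_degreeLT [Finite F] (k : ℕ) : Finite (degreeLT F k) :=
  Finite.of_equiv _ (degreeLTEquiv F k).toEquiv.symm

theorem card_degreeLT (k : ℕ) : Nat.card (degreeLT F k) = Nat.card F ^ k := by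
  rw [Nat.card_congr (degreeLTEquiv F k).toEquiv, Nat.card_fun, Nat.card_fin]

theorem finite_localRing [Finite F] (a : F) (k : ℕ) : Finite (LocalRing a k) := by
  have := finite_degreeLT (F := F) k
  refine Finite.of_surjective (fun p : degreeLT F k => red a k p) fun r => ?_
  obtain ⟨p, rfl⟩ := red_surjective a k r
  have hm : ((X - C a) ^ k).Monic := (monic_X_sub_C a).pow _
  refine ⟨⟨p %ₘ (X - C a) ^ k, ?_⟩, ?_⟩
  · have := degree_modByMonic_lt p hm
    rw [degree_pow, degree_X_sub_C, nsmul_one] at this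
    exact mem_degreeLT.2 this
  · rw [red_eq_iff]
    exact ⟨-(p /ₘ (X - C a) ^ k), by linear_combination modByMonic_add_div p ((X - C a) ^ k)⟩

theorem finite_localWord [Finite F] (a : F) (k l : ℕ) : Finite (LocalWord a k l) := by
  have := finite_localRing a k
  refine Finite.of_injective (fun w : LocalWord a k l => (w.rho, w.vec)) fun w w' h => ?_
  cases w
  cases w'
  simpa using h

/-- A fibre of the linear map `x ↦ c x` on the coset `S + (s)` is not larger than the coset divided
by the size of the image; here the image is bounded below by an injective family. -/
theorem ncard_fibre_mul_le {A : Type*} [CommRing A] [Finite A] {l : ℕ} {ι : Type*} [Finite ι]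
    (b : ι → A) (c s : A) (S y : Fin l → A) (hb : Function.Injective fun t => c * (s * b t)) :
    {r : Fin l → A | (∀ i, s ∣ r i - S i) ∧ ∀ i, y i = c * (r i - S i)}.ncard * Nat.card ι ^ l ≤
      {r : Fin l → A | ∀ i, s ∣ r i - S i}.ncard := by
  have h1 : Nat.card ι ^ l = (Set.univ : Set (Fin l → ι)).ncard := by
    rw [Set.ncard_univ, Nat.card_fun, Nat.card_fin]
  rw [h1, ← Set.ncard_prod]
  refine Set.ncard_le_ncard_of_injOn (fun x i => x.1 i + s * b (x.2 i)) ?_ ?_ (Set.toFinite _)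
  · rintro ⟨r, t⟩ ⟨⟨hr, -⟩, -⟩ i
    rw [show r i + s * b (t i) - S i = (r i - S i) + s * b (t i) by ring]
    exact dvd_add (hr i) (dvd_mul_right _ _)
  · rintro ⟨r, t⟩ ⟨⟨-, hr⟩, -⟩ ⟨r', t'⟩ ⟨⟨-, hr'⟩, -⟩ h
    have ht : t = t' := by
      funext i
      apply hb
      have h2 := congrFun h i
      dsimp only at h2 hr hr' ⊢
      linear_combination c * h2 + hr i - hr' i
    subst ht
    refine Prod.ext (funext fun i => ?_) rfl
    exact add_right_cancel (congrFun h i)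

/-- The vector parts of the entries allowed by the error model at an evaluation error: reduced
with respect to the valuation `ν`, and congruent to `S` modulo `(x - a)^(μ - ν)`. -/
def errorVecs {l : ℕ} {a : F} {k : ℕ} (ν μ : ℕ) (S : Fin l → LocalRing a k) :
    Set (Fin l → LocalRing a k) :=
  {r | (ν ≠ 0 → ∃ i, ¬ unif a k ∣ r i) ∧ ∀ i, unif a k ^ (μ - ν) ∣ r i - S i}

section

variable {l : ℕ} {a : F} {k ν μ s : ℕ} {S r : Fin l → LocalRing a k} {p : Fin l → F[X]}
  {χ ω : F[X]}

theorem ncard_errorRel_mul_le [Finite F] (hνμ : ν ≤ μ) (hμ : μ < k) (hs : s ≤ k - μ)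
    (hω : ω.eval a ≠ 0) (hχ : (X - C a) ^ (k - μ) ∣ χ - (X - C a) ^ s * ω) :
    {r ∈ errorVecs ν μ S | ErrorRel ν μ S p χ r}.ncard * (Nat.card F ^ l) ^ (k - μ - s) ≤
      {r : Fin l → LocalRing a k | ∀ i, unif a k ^ (μ - ν) ∣ r i - S i}.ncard := by
  have := finite_localRing a k
  have := finite_degreeLT (F := F) (k - μ - s)
  have h1 := ncard_fibre_mul_le (fun t : degreeLT F (k - μ - s) => red a k t)
    (unif a k ^ ν * red a k χ) (unif a k ^ (μ - ν)) S (fun i => unif a k ^ μ * red a k (p i)) ?_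
  · rw [card_degreeLT, ← pow_mul, mul_comm _ l, pow_mul] at h1
    refine le_trans (Nat.mul_le_mul_right _ (Set.ncard_le_ncard ?_ (Set.toFinite _))) h1
    exact fun r hr => ⟨hr.1.2, hr.2⟩
  · intro t t' h
    dsimp only at h
    have h2 : red a k ((X - C a) ^ μ * (χ * (t : F[X]))) = red a k ((X - C a) ^ μ * (χ * (t' : F[X]))) := by
      have h3 : unif a k ^ μ = unif a k ^ ν * unif a k ^ (μ - ν) := by
        rw [← pow_add, Nat.add_sub_cancel' hνμ]
      rw [red_mul, red_mul, red_mul, red_mul, ← unif_pow, h3]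
      linear_combination h
    rw [red_eq_iff, ← mul_sub, ← mul_sub] at h2
    have h3 : (X - C a) ^ (k - μ) ∣ χ * ((t : F[X]) - (t' : F[X])) := by
      have h4 : (X - C a) ^ μ * (X - C a) ^ (k - μ) ∣
          (X - C a) ^ μ * (χ * ((t : F[X]) - (t' : F[X]))) := by
        rwa [← pow_add, show μ + (k - μ) = k by omega]
      exact (mul_dvd_mul_iff_left (X_sub_C_pow_ne_zero a μ)).1 h4
    have h5 : (X - C a) ^ s * (X - C a) ^ (k - μ - s) ∣
        (X - C a) ^ s * (ω * ((t : F[X]) - (t' : F[X]))) := by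
      rw [← pow_add, show s + (k - μ - s) = k - μ by omega]
      have h6 := dvd_sub h3 (hχ.mul_right ((t : F[X]) - (t' : F[X])))
      rwa [show χ * ((t : F[X]) - (t' : F[X])) - (χ - (X - C a) ^ s * ω) * ((t : F[X]) - (t' : F[X])) =
        (X - C a) ^ s * (ω * ((t : F[X]) - (t' : F[X]))) by ring] at h6
    have h6 := (isCoprime_of_eval_ne_zero hω _).dvd_of_dvd_mul_left
      ((mul_dvd_mul_iff_left (X_sub_C_pow_ne_zero a s)).1 h5)
    have h7 := (t - t').2
    rw [mem_degreeLT] at h7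
    refine Subtype.ext (sub_eq_zero.1 (eq_zero_of_dvd_of_degree_lt h6 ?_))
    rw [degree_pow, degree_X_sub_C, nsmul_one]
    exact h7

/-- Reducedness removes at most one class modulo `x - a` out of `q^l`. -/
theorem ncard_le_ncard_errorVecs [Finite F] (hk : 0 < k) (S : Fin l → LocalRing a k) (ν : ℕ) :
    {r : Fin l → LocalRing a k | ∀ i, unif a k ^ (ν - ν) ∣ r i - S i}.ncard *
        (Nat.card F ^ l - 1) ≤
      (errorVecs ν ν S).ncard * Nat.card F ^ l := by
  have := finite_localRing a k
  have := finite_degreeLT (F := F) 1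
  have h0 : ∀ x : LocalRing a k, unif a k ^ (ν - ν) ∣ x := fun x => by simp
  have h1 := ncard_fibre_mul_le (l := l) (fun t : degreeLT F 1 => red a k t)
    (unif a k ^ (k - 1)) 1 0 0 ?_
  · rw [card_degreeLT, pow_one] at h1
    have huniv : {r : Fin l → LocalRing a k | ∀ i, unif a k ^ (ν - ν) ∣ r i - S i} =
        Set.univ := by
      ext r
      simp
    have huniv' : {r : Fin l → LocalRing a k | ∀ i, (1 : LocalRing a k) ∣ r i -
        (0 : Fin l → LocalRing a k) i} = Set.univ := by
      ext r
      simp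
    rw [huniv'] at h1
    rw [huniv]
    have h2 : (Set.univ : Set (Fin l → LocalRing a k)).ncard ≤ (errorVecs ν ν S).ncard +
        {r : Fin l → LocalRing a k | (∀ i, (1 : LocalRing a k) ∣ r i -
          (0 : Fin l → LocalRing a k) i) ∧ ∀ i, (0 : Fin l → LocalRing a k) i =
          unif a k ^ (k - 1) * (r i - (0 : Fin l → LocalRing a k) i)}.ncard := by
      refine le_trans (Set.ncard_le_ncard ?_ (Set.toFinite _)) (Set.ncard_union_le _ _)
      intro r _
      by_cases h : ∃ i, ¬ unif a k ∣ r i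
      · exact Or.inl ⟨fun _ => h, fun i => h0 _⟩
      · push Not at h
        refine Or.inr ⟨fun i => one_dvd _, fun i => ?_⟩
        obtain ⟨e, he⟩ := h i
        rw [Pi.zero_apply, sub_zero, he, ← mul_assoc, ← pow_succ, unif_pow_eq_zero (by omega),
          zero_mul]
    set U := (Set.univ : Set (Fin l → LocalRing a k)).ncard
    rw [Nat.mul_sub_one]
    have h3 := Nat.mul_le_mul_right (Nat.card F ^ l) h2
    rw [add_mul] at h3
    omega
  · intro t t' h
    dsimp only at h
    rw [one_mul, one_mul, unif_pow, ← red_mul, ← red_mul, red_eq_iff, ← mul_sub] at h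
    have h4 : (X - C a) ^ (k - 1) * (X - C a) ∣ (X - C a) ^ (k - 1) * ((t : F[X]) - (t' : F[X])) := by
      rwa [← pow_succ, show k - 1 + 1 = k by omega]
    have h7 := (t - t').2
    rw [mem_degreeLT] at h7
    refine Subtype.ext (sub_eq_zero.1 (eq_zero_of_dvd_of_degree_lt
      ((mul_dvd_mul_iff_left (X_sub_C_pow_ne_zero a _)).1 h4) ?_))
    rw [degree_X_sub_C]
    exact h7

/-- If `μ ≠ ν` or `ν = 0`, reducedness is automatic. -/
theorem errorVecs_eq (hνμ : ν ≤ μ) (hres : ¬ (μ = ν ∧ ν ≠ 0))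
    (hS : ν ≠ 0 → ∃ i, ¬ unif a k ∣ S i) :
    errorVecs ν μ S = {r | ∀ i, unif a k ^ (μ - ν) ∣ r i - S i} := by
  ext r
  refine ⟨fun h => h.2, fun h => ⟨fun h0 => ?_, h⟩⟩
  obtain ⟨i, hi⟩ := hS h0
  refine ⟨i, fun hr => hi ?_⟩
  exact (dvd_sub_right hr).1 ((dvd_pow_self _ (by omega)).trans (h i))

open Classical in
/-- The proportion of the errors satisfying a given linear relation, where `s` is the valuation
of the multiplier `χ`. The factor `(1 - q^(-l))⁻¹` is the price of reducedness. -/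
theorem ncard_errorRel_le [Finite F] (hl : 0 < l) (hνμ : ν ≤ μ) (hμ : μ < k) (hs : s ≤ k - μ)
    (hS : ν ≠ 0 → ∃ i, ¬ unif a k ∣ S i)
    (hω : ω.eval a ≠ 0) (hχ : (X - C a) ^ (k - μ) ∣ χ - (X - C a) ^ s * ω) :
    ({r ∈ errorVecs ν μ S | ErrorRel ν μ S p χ r}.ncard : ℝ) ≤
      (errorVecs ν μ S).ncard * (((Nat.card F : ℝ) ^ l) ^ (k - μ - s))⁻¹ *
        (if μ = ν ∧ ν ≠ 0 ∧ s < k - μ then 1 - 1 / (Nat.card F : ℝ) ^ l else 1)⁻¹ := by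
  have := finite_localRing a k
  have hq : 1 < Nat.card F := Finite.one_lt_card
  have hQ : 1 < (Nat.card F : ℝ) ^ l := one_lt_pow₀ (by exact_mod_cast hq) hl.ne'
  set Q : ℝ := (Nat.card F : ℝ) ^ l with hQdef
  have hQ0 : 0 < Q := by linarith
  have hpow : 0 < Q ^ (k - μ - s) := pow_pos hQ0 _
  have h1 : ({r ∈ errorVecs ν μ S | ErrorRel ν μ S p χ r}.ncard : ℝ) * Q ^ (k - μ - s) ≤
      ({r : Fin l → LocalRing a k | ∀ i, unif a k ^ (μ - ν) ∣ r i - S i}.ncard : ℝ) := by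
    rw [hQdef]
    exact_mod_cast ncard_errorRel_mul_le (S := S) (p := p) hνμ hμ hs hω hχ
  split_ifs with h
  · obtain ⟨rfl, h0, hs'⟩ := h
    have h2 := ncard_le_ncard_errorVecs (by omega) S μ
    have h3 : ({r : Fin l → LocalRing a k | ∀ i, unif a k ^ (μ - μ) ∣ r i - S i}.ncard : ℝ) *
        (Q - 1) ≤ ((errorVecs μ μ S).ncard : ℝ) * Q := by
      have h4 : ((Nat.card F ^ l - 1 : ℕ) : ℝ) = Q - 1 := by
        rw [Nat.cast_sub (Nat.one_le_pow _ _ (by omega))]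
        push_cast
        rfl
      rw [← h4, hQdef]
      exact_mod_cast h2
    have h5 : (0 : ℝ) < 1 - 1 / Q := by
      rw [sub_pos, div_lt_one hQ0]
      exact hQ
    rw [← div_eq_mul_inv, ← div_eq_mul_inv, div_div, le_div_iff₀ (by positivity), ← mul_assoc]
    have h6 := mul_le_mul_of_nonneg_right h1 h5.le
    refine h6.trans ?_
    rw [show (1 : ℝ) - 1 / Q = (Q - 1) / Q by field_simp, ← mul_div_assoc, div_le_iff₀ hQ0]
    exact h3
  · rw [inv_one, mul_one, ← div_eq_mul_inv, le_div_iff₀ hpow]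
    by_cases hres : μ = ν ∧ ν ≠ 0
    · have hs' : k - μ - s = 0 := by
        by_contra hne
        exact h ⟨hres.1, hres.2, by omega⟩
      rw [hs', pow_zero, mul_one]
      exact_mod_cast Set.ncard_le_ncard (Set.sep_subset (errorVecs ν μ S) _) (Set.toFinite _)
    · rw [errorVecs_eq hνμ hres hS] at h1 ⊢
      exact h1

theorem exists_error_of_errorRel (hνμ : ν ≤ μ) (hμ : μ < k)
    (hχ : (X - C a) ^ (k - μ) ∣ χ - (X - C a) ^ s * ω)
    (hr : r ∈ errorVecs ν μ S) (h : ErrorRel ν μ S p χ r) :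
    ∃ e : Fin l → F[X], (∀ i, r i = S i + unif a k ^ (μ - ν) * red a k (e i)) ∧
      ∀ i, (X - C a) ^ (k - μ) ∣ p i - (X - C a) ^ s * ω * e i := by
  choose e he using hr.2
  choose e' he' using fun i => red_surjective a k (e i)
  refine ⟨e', fun i => ?_, fun i => ?_⟩
  · rw [he', ← he i]
    ring
  · have h1 := h i
    rw [he i, ← he' i] at h1
    have h2 : red a k ((X - C a) ^ μ * p i) = red a k ((X - C a) ^ μ * (χ * e' i)) := by
      have h3 : unif a k ^ μ = unif a k ^ ν * unif a k ^ (μ - ν) := by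
        rw [← pow_add, Nat.add_sub_cancel' hνμ]
      rw [red_mul, red_mul, red_mul, ← unif_pow, h1, h3]
      ring
    rw [red_eq_iff, ← mul_sub] at h2
    have h3 : (X - C a) ^ (k - μ) ∣ p i - χ * e' i := by
      have h4 : (X - C a) ^ μ * (X - C a) ^ (k - μ) ∣ (X - C a) ^ μ * (p i - χ * e' i) := by
        rwa [← pow_add, show μ + (k - μ) = k by omega]
      exact (mul_dvd_mul_iff_left (X_sub_C_pow_ne_zero a μ)).1 h4
    have h5 := dvd_add h3 (hχ.mul_right (e' i))
    rwa [show p i - χ * e' i + (χ - (X - C a) ^ s * ω) * e' i =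
      p i - (X - C a) ^ s * ω * e' i by ring] at h5

theorem pow_dvd_of_errorRel (hνμ : ν ≤ μ) (hμ : μ < k) (hs : s ≤ k - μ)
    (hχ : (X - C a) ^ (k - μ) ∣ χ - (X - C a) ^ s * ω)
    (hr : r ∈ errorVecs ν μ S) (h : ErrorRel ν μ S p χ r) (i : Fin l) :
    (X - C a) ^ s ∣ p i := by
  obtain ⟨e, -, he⟩ := exists_error_of_errorRel hνμ hμ hχ hr h
  refine (dvd_sub_left ?_).1 ((pow_dvd_pow _ hs).trans (he i))
  exact (dvd_mul_right _ _).mul_right _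

/-- When reducedness is a constraint, it forbids a nonzero value of `p / η` at `a`. -/
theorem exists_forbidden_value (hμ : μ < k) (hν : ν ≠ 0) (hs : s < k - ν)
    (hS : ∃ i, ¬ unif a k ∣ S i) (hνμ : μ = ν)
    (hω : ω.eval a ≠ 0) (hχ : (X - C a) ^ (k - μ) ∣ χ - (X - C a) ^ s * ω)
    {η : F[X]} (hη : η.eval a ≠ 0) :
    ∃ c : Fin l → F, c ≠ 0 ∧ ∀ (p : Fin l → F[X]), ∀ r ∈ errorVecs ν μ S,
      ErrorRel ν μ S (fun i => (X - C a) ^ s * η * p i) χ r →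
      (fun i => (p i).eval a) ≠ c := by
  subst hνμ
  choose S' hS' using fun i => red_surjective a k (S i)
  have hdvd : ∀ P : F[X], unif a k ∣ red a k P ↔ P.eval a = 0 := fun P => by
    rw [← pow_one (unif a k), unif_pow_dvd_red (by omega), pow_one, dvd_iff_isRoot, IsRoot.def]
  refine ⟨fun i => -(S' i).eval a * ω.eval a / η.eval a, ?_, ?_⟩
  · obtain ⟨i, hi⟩ := hS
    rw [← hS' i, hdvd] at hi
    refine fun h => ?_
    have h1 := congrFun h i
    simp only [Pi.zero_apply, div_eq_zero_iff, mul_eq_zero, neg_eq_zero] at h1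
    tauto
  · intro p r hr h hcon
    obtain ⟨e, he, he'⟩ := exists_error_of_errorRel le_rfl hμ hχ hr h
    obtain ⟨i, hi⟩ := hr.1 hν
    apply hi
    have h1 := he i
    rw [Nat.sub_self, pow_zero, one_mul, ← hS' i, ← red_add] at h1
    rw [h1, hdvd, eval_add]
    have h2 := he' i
    rw [show (X - C a) ^ s * η * p i - (X - C a) ^ s * ω * e i =
      (X - C a) ^ s * (η * p i - ω * e i) by ring] at h2
    have h3 : (X - C a) ^ s * (X - C a) ∣ (X - C a) ^ s * (η * p i - ω * e i) := by
      rw [← pow_succ]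
      exact (pow_dvd_pow _ (by omega)).trans h2
    have h4 := (mul_dvd_mul_iff_left (X_sub_C_pow_ne_zero a s)).1 h3
    rw [dvd_iff_isRoot, IsRoot.def, eval_sub, eval_mul, eval_mul] at h4
    have h5 : (p i).eval a = -(S' i).eval a * ω.eval a / η.eval a := congrFun hcon i
    rw [h5, mul_div_cancel₀ _ hη] at h4
    have h6 : ω.eval a * ((S' i).eval a + (e i).eval a) = 0 := by
      linear_combination -h4
    exact (mul_eq_zero.1 h6).resolve_left hω

/-- The valuation of a multiplier modulo `(x - a)^m`. -/
theorem exists_valuation (a : F) (m : ℕ) (χ : F[X]) :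
    ∃ (s : ℕ) (ω : F[X]), s ≤ m ∧ ω.eval a ≠ 0 ∧ (X - C a) ^ m ∣ χ - (X - C a) ^ s * ω := by
  rcases (polyVal_le a m χ).lt_or_eq with h | h
  · obtain ⟨ω, h1, h2⟩ := exists_eq_pow_polyVal_mul h
    exact ⟨_, ω, h.le, h2, by simp [← h1]⟩
  · refine ⟨m, 1, le_rfl, by simp, dvd_sub ?_ (dvd_mul_right _ _)⟩
    conv_lhs => rw [← h]
    exact pow_polyVal_dvd a m χ

end

/-! ### Vectors of polynomials avoiding given values -/

/-- The vectors of `l` polynomials of degree less than `D`. -/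
def vecLT (F : Type*) [Field F] (l D : ℕ) : Set (Fin l → F[X]) := {p | ∀ i, p i ∈ degreeLT F D}

theorem finite_vecLT [Finite F] (l D : ℕ) : (vecLT F l D).Finite := by
  have := finite_degreeLT (F := F) D
  exact Finite.of_equiv _ (Equiv.subtypePiEquivPi (p := fun _ q => q ∈ degreeLT F D)).symm

theorem ncard_vecLT (l D : ℕ) : (vecLT F l D).ncard = (Nat.card F ^ l) ^ D := by
  have e : vecLT F l D ≃ (Fin l → degreeLT F D) :=
    Equiv.subtypePiEquivPi (p := fun _ q => q ∈ degreeLT F D)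
  rw [← Nat.card_coe_set_eq, Nat.card_congr e, Nat.card_fun, Nat.card_fin, card_degreeLT,
    pow_right_comm]

theorem card_ne {A : Type*} [Finite A] {l : ℕ} (c : Fin l → A) :
    Nat.card {v : Fin l → A // v ≠ c} = Nat.card A ^ l - 1 := by
  have := Fintype.ofFinite A
  classical
  rw [Nat.card_eq_fintype_card, Fintype.card_subtype_compl, Fintype.card_subtype_eq,
    Fintype.card_fun, Fintype.card_fin, Nat.card_eq_fintype_card]

section

variable [Finite F] {n l D : ℕ} {α : Fin n → F} {J : Finset (Fin n)} {c : Fin n → Fin l → F}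
  {S : Set (Fin l → F[X])}

/-- For at most `D` points, a polynomial is determined by its values at the points of `J` and its
quotient by `∏ (x - α_j)`, which has degree less than `D - |J|`. -/
theorem ncard_avoid_le_of_card_le (hα : Function.Injective α) (hJ : J.card ≤ D)
    (hS : S ⊆ vecLT F l D)
    (hc : ∀ p ∈ S, ∀ j ∈ J, (fun i => (p i).eval (α j)) ≠ c j) :
    S.ncard ≤ (Nat.card F ^ l - 1) ^ J.card * (Nat.card F ^ l) ^ (D - J.card) := by
  classical
  have hfin := finite_vecLT (F := F) l (D - J.card)
  have : Finite (vecLT F l (D - J.card)) := hfin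
  set P : F[X] := ∏ j ∈ J, (X - C (α j)) ^ (fun _ => 1 : Fin n → ℕ) j with hP
  have hPm : P.Monic := monic_prod_of_monic _ _ fun j _ => (monic_X_sub_C (α j)).pow _
  have hPd : P.natDegree = J.card := by
    rw [hP, natDegree_prod_X_sub_C_pow]
    simp
  have hmem : ∀ p ∈ S, (fun i => p i /ₘ P) ∈ vecLT F l (D - J.card) := by
    intro p hp i
    rw [mem_degreeLT]
    beta_reduce
    rcases eq_or_ne (p i /ₘ P) 0 with h0 | h0
    · rw [h0, degree_zero]
      exact WithBot.bot_lt_coe _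
    · have h1 := mem_degreeLT.1 (hS hp i)
      have hp0 : p i ≠ 0 := by
        intro h
        rw [h, zero_divByMonic] at h0
        exact h0 rfl
      rw [← natDegree_lt_iff_degree_lt hp0] at h1
      rw [← natDegree_lt_iff_degree_lt h0, natDegree_divByMonic _ hPm, hPd]
      have h2 : J.card ≤ (p i).natDegree := by
        by_contra! hlt
        refine h0 ((divByMonic_eq_zero_iff hPm).2 ?_)
        exact degree_lt_degree (by rwa [hPd])
      omega
  have hinj : Function.Injective (fun p : S =>
      ((fun j : J => ⟨fun i => (p.1 i).eval (α j), hc p.1 p.2 j j.2⟩,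
        ⟨fun i => p.1 i /ₘ P, hmem p.1 p.2⟩) :
        ((j : J) → {v : Fin l → F // v ≠ c j}) × vecLT F l (D - J.card))) := by
    rintro ⟨p, hp⟩ ⟨p', hp'⟩ h
    rw [Prod.mk.injEq] at h
    obtain ⟨h1, h2⟩ := h
    refine Subtype.ext (funext fun i => sub_eq_zero.1 ?_)
    have h3 : p i /ₘ P = p' i /ₘ P := congrFun (congrArg Subtype.val h2) i
    have h4 : p i - p' i = p i %ₘ P - p' i %ₘ P := by
      have e1 := modByMonic_add_div (p i) P
      have e2 := modByMonic_add_div (p' i) P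
      rw [h3] at e1
      linear_combination e2 - e1
    have h5 : P ∣ p i - p' i := prod_X_sub_C_pow_dvd hα fun j hj => by
      rw [pow_one, dvd_iff_isRoot, IsRoot.def, eval_sub, sub_eq_zero]
      exact congrFun (congrArg Subtype.val (congrFun h1 ⟨j, hj⟩)) i
    refine eq_zero_of_dvd_of_degree_lt h5 ?_
    rw [h4]
    exact (degree_sub_le _ _).trans_lt
      (max_lt (degree_modByMonic_lt _ hPm) (degree_modByMonic_lt _ hPm))
  have h := Nat.card_le_card_of_injective _ hinj
  rw [Nat.card_prod, Nat.card_pi, Nat.card_coe_set_eq, Nat.card_coe_set_eq, ncard_vecLT] at h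
  simpa only [card_ne, Finset.prod_const, Finset.card_univ, Fintype.card_coe] using h

/-- Nonzero constant vectors that avoid a nonzero vector. -/
theorem ncard_avoid_const_le (hS : S ⊆ vecLT F l 1) (h0 : ∀ p ∈ S, p ≠ 0) {j : Fin n}
    (hj : c j ≠ 0) (hc : ∀ p ∈ S, (fun i => (p i).eval (α j)) ≠ c j) :
    S.ncard + 2 ≤ Nat.card F ^ l := by
  classical
  have h1 : ∀ p ∈ S, ∀ i, p i = C ((p i).eval (α j)) := by
    intro p hp i
    have h := mem_degreeLT.1 (hS hp i)
    have h2 := eq_C_of_degree_le_zero (p := p i) (by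
      rcases eq_or_ne (p i) 0 with h0 | h0
      · simp [h0]
      · rw [← natDegree_lt_iff_degree_lt h0] at h
        rw [← natDegree_eq_zero_iff_degree_le_zero]
        omega)
    rw [h2, eval_C]
  have h2 : S.ncard ≤ ({0, c j}ᶜ : Set (Fin l → F)).ncard := by
    refine Set.ncard_le_ncard_of_injOn (fun p i => (p i).eval (α j)) ?_ ?_ (Set.toFinite _)
    · intro p hp hmem
      rcases hmem with h | h
      · refine h0 p hp (funext fun i => ?_)
        rw [h1 p hp i, show (p i).eval (α j) = 0 from congrFun h i, C_0, Pi.zero_apply]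
      · exact hc p hp h
    · intro p hp p' hp' h
      funext i
      rw [h1 p hp i, h1 p' hp' i, show (p i).eval (α j) = (p' i).eval (α j) from congrFun h i]
  have h3 := Set.ncard_add_ncard_compl ({0, c j} : Set (Fin l → F))
  rw [Set.ncard_pair hj.symm, Nat.card_fun, Nat.card_fin] at h3
  omega

/-- The nonzero vectors of degree less than `D` avoiding a nonzero value at each point of `J` are at
most `q - 1` times as many as if their values at the points of `J` were independent. When there
are more points than degrees of freedom, this uses that `J` has at most `q` points: for `q ≥ 3`
the factor `q - 1` makes up for all the constraints, and for `q = 2` only constant vectors and two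
points remain. -/
theorem ncard_avoid_le (hα : Function.Injective α) (hl : 2 ≤ l) (hD : 0 < D)
    (hS : S ⊆ vecLT F l D) (h0 : ∀ p ∈ S, p ≠ 0) (hcne : ∀ j ∈ J, c j ≠ 0)
    (hc : ∀ p ∈ S, ∀ j ∈ J, (fun i => (p i).eval (α j)) ≠ c j) :
    (S.ncard : ℝ) ≤ ((Nat.card F : ℝ) - 1) * ((Nat.card F : ℝ) ^ l) ^ D *
      (1 - 1 / (Nat.card F : ℝ) ^ l) ^ J.card := by
  classical
  have hq : 1 < Nat.card F := Finite.one_lt_card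
  have hJq : J.card ≤ Nat.card F := by
    have := Fintype.ofFinite F
    rw [Nat.card_eq_fintype_card, ← Finset.card_image_of_injective J hα]
    exact Finset.card_le_univ _
  set q := Nat.card F with hqdef
  have hq2 : (2 : ℝ) ≤ q := by exact_mod_cast hq
  set Q : ℝ := (q : ℝ) ^ l with hQ
  have hqQ : (q : ℝ) ^ 2 ≤ Q := pow_le_pow_right₀ (by linarith) hl
  have hQ4 : 4 ≤ Q := by nlinarith
  have hQ0 : 0 < Q := by linarith
  have hw0 : 0 ≤ 1 - 1 / Q := by
    rw [sub_nonneg, div_le_one hQ0]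
    linarith
  by_cases hq3 : 3 ≤ q
  · have h1 : (S.ncard : ℝ) ≤ Q ^ D := by
      have := Set.ncard_le_ncard hS (finite_vecLT l D)
      rw [ncard_vecLT] at this
      rw [hQ]
      exact_mod_cast this
    refine h1.trans ?_
    have h3 : (1 : ℝ) - 1 / q ≤ (1 - 1 / Q) ^ J.card := by
      have hB := one_add_mul_le_pow (a := -(1 / Q)) (by linarith) q
      have h4 : (1 - 1 / Q) ^ q ≤ (1 - 1 / Q) ^ J.card :=
        pow_le_pow_of_le_one hw0 (by linarith [one_div_pos.2 hQ0]) hJq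
      have h5 : (q : ℝ) * (1 / Q) ≤ 1 / q := by
        rw [mul_one_div, div_le_div_iff₀ hQ0 (by linarith)]
        nlinarith
      rw [← sub_eq_add_neg] at hB
      linarith
    have hq3' : (3 : ℝ) ≤ q := by exact_mod_cast hq3
    have h6 : 1 ≤ ((q : ℝ) - 1) * (1 - 1 / Q) ^ J.card := by
      refine le_trans ?_ (mul_le_mul_of_nonneg_left h3 (by linarith))
      rw [show ((q : ℝ) - 1) * (1 - 1 / q) = ((q : ℝ) - 1) ^ 2 / q by field_simp,
        le_div_iff₀ (by linarith)]
      nlinarith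
    have hQD : 0 < Q ^ D := pow_pos hQ0 D
    nlinarith
  · have hq2' : q = 2 := by omega
    have hqr : (q : ℝ) - 1 = 1 := by
      rw [hq2']
      norm_num
    rw [hqr, one_mul]
    by_cases hJD : J.card ≤ D
    · have h1 := ncard_avoid_le_of_card_le hα hJD hS hc
      have h2 : (S.ncard : ℝ) ≤ (Q - 1) ^ J.card * Q ^ (D - J.card) := by
        have h4 : ((q ^ l - 1 : ℕ) : ℝ) = Q - 1 := by
          rw [Nat.cast_sub (Nat.one_le_pow _ _ (by omega))]
          push_cast
          rfl
        rw [← h4, hQ]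
        exact_mod_cast h1
      refine h2.trans (le_of_eq ?_)
      rw [show (1 : ℝ) - 1 / Q = (Q - 1) / Q by field_simp, div_pow, mul_comm,
        ← Nat.sub_add_cancel hJD, Nat.add_sub_cancel, pow_add]
      field_simp
    · obtain rfl : D = 1 := by omega
      have hJ2 : J.card = 2 := by omega
      obtain ⟨j, hj⟩ : J.Nonempty := Finset.card_pos.1 (by omega)
      have h1 := ncard_avoid_const_le hS h0 (hcne j hj) fun p hp => hc p hp j hj
      have h2 : (S.ncard : ℝ) + 2 ≤ Q := by
        rw [hQ]
        exact_mod_cast h1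
      rw [hJ2, pow_one, show Q * (1 - 1 / Q) ^ 2 = Q - 2 + 1 / Q by field_simp; ring]
      have := one_div_pos.2 hQ0
      linarith

end

/-! ### The union bound over the possible error relations -/

/-- The bound for fixed multipliers of valuations `s j`: all the vectors `p` that contribute are
multiples of `η = ∏ (x - α_j)^(s j)`, and the loss `w⁻¹` at the points of `J` is compensated by the
forbidden values of `p / η` there. -/
theorem sum_prod_le [Finite F] {n l D : ℕ} (hl : 2 ≤ l) {α : Fin n → F}
    (hα : Function.Injective α) {ξ J : Finset (Fin n)} (hJ : J ⊆ ξ) {m s : Fin n → ℕ}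
    (hs : ∀ j ∈ ξ, s j ≤ m j) {c : Fin n → Fin l → F} (hc : ∀ j ∈ J, c j ≠ 0)
    {h : Fin n → (Fin l → F[X]) → ℝ} (h0 : ∀ j p, 0 ≤ h j p)
    (hle : ∀ j ∈ ξ, ∀ p, h j p ≤ (((Nat.card F : ℝ) ^ l) ^ (m j - s j))⁻¹ *
      (if j ∈ J then 1 - 1 / (Nat.card F : ℝ) ^ l else 1)⁻¹)
    (hdvd : ∀ j ∈ ξ, ∀ p, h j p ≠ 0 → ∀ i, (X - C (α j)) ^ s j ∣ p i)
    (havoid : ∀ j ∈ J, ∀ p : Fin l → F[X],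
      h j (fun i => (∏ j ∈ ξ, (X - C (α j)) ^ s j) * p i) ≠ 0 →
        (fun i => (p i).eval (α j)) ≠ c j)
    (P : Finset (Fin l → F[X])) (hP : ∀ p ∈ P, p ∈ vecLT F l D ∧ p ≠ 0) :
    ∑ p ∈ P, ∏ j ∈ ξ, h j p ≤ ((Nat.card F : ℝ) - 1) * ((Nat.card F : ℝ) ^ l) ^ D *
      (((Nat.card F : ℝ) ^ l) ^ ∑ j ∈ ξ, m j)⁻¹ := by
  classical
  have hq : (1 : ℝ) < Nat.card F := by exact_mod_cast Finite.one_lt_card (α := F)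
  have hQ1 : 1 < (Nat.card F : ℝ) ^ l := one_lt_pow₀ hq (by omega)
  set Q : ℝ := (Nat.card F : ℝ) ^ l
  have hQ0 : 0 < Q := by linarith
  have hw0 : 0 < 1 - 1 / Q := by
    rw [sub_pos, div_lt_one hQ0]
    exact hQ1
  set w := 1 - 1 / Q
  set η := ∏ j ∈ ξ, (X - C (α j)) ^ s j with hηdef
  have hη0 : η ≠ 0 := Finset.prod_ne_zero_iff.2 fun j _ => X_sub_C_pow_ne_zero _ _
  have hηd : η.natDegree = ∑ j ∈ ξ, s j := natDegree_prod_X_sub_C_pow _ _ _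
  have hrhs : 0 ≤ ((Nat.card F : ℝ) - 1) * Q ^ D * (Q ^ ∑ j ∈ ξ, m j)⁻¹ := by
    have : 0 ≤ (Nat.card F : ℝ) - 1 := by linarith
    positivity
  set P' := P.filter fun p => ∏ j ∈ ξ, h j p ≠ 0 with hP'
  rw [← Finset.sum_filter_ne_zero]
  rcases P'.eq_empty_or_nonempty with hemp | ⟨p₀, hp₀⟩
  · rw [← hP', hemp, Finset.sum_empty]
    exact hrhs
  have hηp : ∀ p ∈ P', ∀ i, η ∣ p i := fun p hp i =>
    prod_X_sub_C_pow_dvd hα fun j hj =>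
      hdvd j hj p (Finset.prod_ne_zero_iff.1 (Finset.mem_filter.1 hp).2 j hj) i
  have hdeg : ∀ x : F[X], x ≠ 0 → η * x ∈ degreeLT F D → η.natDegree + x.natDegree < D := by
    intro x hx h1
    rwa [mem_degreeLT, ← natDegree_lt_iff_degree_lt (mul_ne_zero hη0 hx),
      natDegree_mul hη0 hx] at h1
  have hD : η.natDegree < D := by
    obtain ⟨hmem, hne⟩ := hP p₀ (Finset.mem_filter.1 hp₀).1
    obtain ⟨i, hi⟩ := Function.ne_iff.1 hne
    obtain ⟨x, hx⟩ := hηp p₀ hp₀ i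
    have hx0 : x ≠ 0 := by
      rintro rfl
      exact hi (by rw [hx, mul_zero, Pi.zero_apply])
    have := hdeg x hx0 (hx ▸ hmem i)
    omega
  set S : Set (Fin l → F[X]) := {x | (fun i => η * x i) ∈ P'}
  have hS : S ⊆ vecLT F l (D - η.natDegree) := by
    intro x hx i
    have h1 := (hP _ (Finset.mem_filter.1 hx).1).1 i
    rw [mem_degreeLT]
    rcases eq_or_ne (x i) 0 with hx0 | hx0
    · rw [hx0, degree_zero]
      exact WithBot.bot_lt_coe _
    · rw [← natDegree_lt_iff_degree_lt hx0]
      have := hdeg _ hx0 h1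
      omega
  have hcard : (P'.card : ℝ) ≤ ((Nat.card F : ℝ) - 1) * Q ^ (D - η.natDegree) * w ^ J.card := by
    have h1 : P'.card ≤ S.ncard := by
      rw [← Set.ncard_coe_finset]
      choose! x hx using hηp
      refine Set.ncard_le_ncard_of_injOn x ?_ ?_ ((finite_vecLT l _).subset hS)
      · intro p hp
        change (fun i => η * x p i) ∈ P'
        rwa [← show p = fun i => η * x p i from funext (hx p hp)]
      · intro p hp p' hp' heq
        funext i
        rw [hx p hp i, hx p' hp' i, heq]
    have h2 : (P'.card : ℝ) ≤ S.ncard := by exact_mod_cast h1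
    refine h2.trans (ncard_avoid_le hα hl (by omega) hS ?_ hc ?_)
    · rintro x hx rfl
      refine (hP _ (Finset.mem_filter.1 hx).1).2 (funext fun i => ?_)
      exact mul_zero _
    · intro x hx j hj
      exact havoid j hj x (Finset.prod_ne_zero_iff.1 (Finset.mem_filter.1 hx).2 j (hJ hj))
  have hterm : ∀ p ∈ P', ∏ j ∈ ξ, h j p ≤
      (Q ^ (∑ j ∈ ξ, m j - η.natDegree))⁻¹ * (w ^ J.card)⁻¹ := by
    intro p _
    refine (Finset.prod_le_prod (fun j _ => h0 j p) fun j hj => hle j hj p).trans (le_of_eq ?_)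
    rw [Finset.prod_mul_distrib, Finset.prod_inv_distrib, Finset.prod_inv_distrib,
      Finset.prod_pow_eq_pow_sum, Finset.prod_ite_mem, Finset.inter_eq_right.2 hJ,
      Finset.prod_const, hηd, Finset.sum_tsub_distrib _ hs]
  rw [← hP']
  refine (Finset.sum_le_card_nsmul P' _ _ hterm).trans ?_
  rw [nsmul_eq_mul]
  refine (mul_le_mul_of_nonneg_right hcard (by positivity)).trans (le_of_eq ?_)
  have hsm : η.natDegree ≤ ∑ j ∈ ξ, m j := by
    rw [hηd]
    exact Finset.sum_le_sum hs
  obtain ⟨M, hM⟩ := Nat.exists_eq_add_of_le hsm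
  obtain ⟨E, hE⟩ := Nat.exists_eq_add_of_le hD.le
  rw [hM, hE, Nat.add_sub_cancel_left, Nat.add_sub_cancel_left, pow_add, pow_add]
  have hwJ : w ^ J.card ≠ 0 := (pow_pos hw0 _).ne'
  field_simp

section

variable {n l : ℕ} {α : Fin n → F} {lam : Fin n → ℕ}

/-- The entries that the error model allows at the `j`-th evaluation point. -/
def localModel (f : Fin l → F[X]) (g : F[X]) (ξe ξv : Finset (Fin n)) (μ : Fin n → ℕ)
    (W : Word α lam l) (j : Fin n) : Set (LocalWord (α j) (lam j) l) :=
  {w | w.IsReduced ∧ (j ∉ ξe → j ∉ ξv → w.Equiv (encode α lam f g j)) ∧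
    (j ∈ ξv → w.Equiv (W j)) ∧
    (j ∈ ξe → (w.rho : ℕ) = polyVal (α j) (lam j) g ∧
      μ j - polyVal (α j) (lam j) g ≤
        vecVal (fun i => w.vec i - evVec (α j) (lam j) f g i))}

variable {f : Fin l → F[X]} {g : F[X]}
  {ξe ξv : Finset (Fin n)} {μ : Fin n → ℕ} {W : Word α lam l}

theorem errorModel_eq_pi :
    errorModel f g ξe ξv μ W = Set.pi Set.univ (localModel f g ξe ξv μ W) := by
  ext R
  simp only [errorModel, localModel, Set.mem_ofPred_eq, Set.mem_pi, Set.mem_univ, true_imp_iff]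
  exact ⟨fun h j => ⟨h.1 j, h.2.1 j, h.2.2.1 j, h.2.2.2 j⟩,
    fun h => ⟨fun j => (h j).1, fun j => (h j).2.1, fun j => (h j).2.2.1, fun j => (h j).2.2.2⟩⟩

theorem encode_mem_localModel (hl : 0 < l) (hfg : CoprimeFamily f g)
    (hW : IsErrorPattern g ξe ξv μ W) {j : Fin n} (hv : j ∉ ξv) :
    encode α lam f g j ∈ localModel f g ξe ξv μ W j := by
  refine ⟨encode_isReduced hl hfg j, fun _ _ i => rfl, fun h => absurd h hv,
    fun h => ⟨encode_rho α lam f g j, ?_⟩⟩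
  rw [le_vecVal_iff (by have := hW.mu_le j; omega)]
  intro i
  simp [encode]

theorem localModel_nonempty (hl : 0 < l) (hfg : CoprimeFamily f g)
    (hW : IsErrorPattern g ξe ξv μ W) (j : Fin n) :
    (localModel f g ξe ξv μ W j).Nonempty := by
  by_cases hv : j ∈ ξv
  · exact ⟨W j, hW.reduced j hv, fun _ h => absurd hv h, fun _ i => rfl,
      fun he => absurd hv (Finset.disjoint_left.1 hW.disjoint he)⟩
  · exact ⟨_, encode_mem_localModel hl hfg hW hv⟩

theorem ncard_localModel_sep (hW : IsErrorPattern g ξe ξv μ W) {j : Fin n} (he : j ∈ ξe)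
    (T : (Fin l → LocalRing (α j) (lam j)) → Prop) :
    {w ∈ localModel f g ξe ξv μ W j | T w.vec}.ncard =
      {r ∈ errorVecs (polyVal (α j) (lam j) g) (μ j) (evVec (α j) (lam j) f g) | T r}.ncard := by
  have hle : μ j - polyVal (α j) (lam j) g ≤ lam j := by
    have := hW.mu_le j
    omega
  refine Set.ncard_congr (fun w _ => w.vec) ?_ ?_ ?_
  · rintro w ⟨⟨h1, -, -, h2⟩, hT⟩
    obtain ⟨h3, h4⟩ := h2 he
    rw [isReduced_iff, h3] at h1
    exact ⟨⟨h1, (le_vecVal_iff hle).1 h4⟩, hT⟩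
  · rintro ⟨ρ, r⟩ ⟨ρ', r'⟩ ⟨⟨-, -, -, h2⟩, -⟩ ⟨⟨-, -, -, h2'⟩, -⟩ (h : r = r')
    have h3 : ρ = ρ' := Fin.ext ((h2 he).1.trans (h2' he).1.symm)
    rw [h, h3]
  · rintro r ⟨⟨h1, h2⟩, hT⟩
    refine ⟨⟨⟨polyVal (α j) (lam j) g, Nat.lt_succ_of_le (polyVal_le _ _ _)⟩, r⟩,
      ⟨⟨isReduced_iff.2 h1, fun h => absurd he h,
        fun hv => absurd hv (Finset.disjoint_left.1 hW.disjoint he),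
        fun _ => ⟨rfl, (le_vecVal_iff hle).2 h2⟩⟩, hT⟩, rfl⟩

theorem ncard_pi {ι : Type*} [Fintype ι] {β : ι → Type*} (s : ∀ i, Set (β i)) :
    (Set.pi Set.univ s).ncard = ∏ i, (s i).ncard := by
  rw [← Nat.card_coe_set_eq, Nat.card_congr (Equiv.Set.univPi s), Nat.card_pi]
  rfl

theorem finite_word [Finite F] : Finite (Word α lam l) := by
  have := fun j => finite_localWord (α j) (lam j) l
  infer_instance

/-- The expected number of vectors `p` that realize given multipliers `χ`. -/
theorem sum_ncard_errorRel_le [Finite F] (hl : 2 ≤ l) (hα : Function.Injective α)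
    (hfg : CoprimeFamily f g) (hW : IsErrorPattern g ξe ξv μ W) {D : ℕ} (χ : Fin n → F[X])
    (P : Finset (Fin l → F[X])) (hP : ∀ p ∈ P, p ∈ vecLT F l D ∧ p ≠ 0) :
    ∑ p ∈ P, ({R ∈ errorModel f g ξe ξv μ W | ∀ j ∈ ξe,
        ErrorRel (polyVal (α j) (lam j) g) (μ j) (evVec (α j) (lam j) f g) p (χ j)
          (R j).vec}.ncard : ℝ) ≤
      (errorModel f g ξe ξv μ W).ncard * (((Nat.card F : ℝ) - 1) * ((Nat.card F : ℝ) ^ l) ^ D *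
        (((Nat.card F : ℝ) ^ l) ^ ∑ j ∈ ξe, (lam j - μ j))⁻¹) := by
  classical
  have hfin := fun j => finite_localWord (α j) (lam j) l
  choose s ω hs hω hχ using fun j => exists_valuation (α j) (lam j - μ j) (χ j)
  set ν : Fin n → ℕ := fun j => polyVal (α j) (lam j) g
  set S : ∀ j, Fin l → LocalRing (α j) (lam j) := fun j => evVec (α j) (lam j) f g
  have hS : ∀ j ∈ ξe, ν j ≠ 0 → ∃ i, ¬ unif (α j) (lam j) ∣ S j i := fun j hj h0 =>
    exists_not_dvd_evVec hfg h0
      ((hW.mu_of_mem_e j hj).1.trans_lt (hW.mu_of_mem_e j hj).2)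
  set N : Fin n → ℕ := fun j => (localModel f g ξe ξv μ W j).ncard
  have hNpos : ∀ j, (0 : ℝ) < N j := fun j => by
    exact_mod_cast (Set.ncard_pos (Set.toFinite _)).2
      (localModel_nonempty (by omega) hfg hW j)
  set h : Fin n → (Fin l → F[X]) → ℝ := fun j p =>
    ({w ∈ localModel f g ξe ξv μ W j | ErrorRel (ν j) (μ j) (S j) p (χ j) w.vec}.ncard : ℝ) / N j
    with hh
  have hmem : ∀ j ∈ ξe, ∀ p, h j p ≠ 0 →
      ∃ r ∈ errorVecs (ν j) (μ j) (S j), ErrorRel (ν j) (μ j) (S j) p (χ j) r := by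
    intro j hj p hp
    have h1 := left_ne_zero_of_mul hp
    rw [ncard_localModel_sep hW hj, Nat.cast_ne_zero] at h1
    exact Set.nonempty_of_ncard_ne_zero h1
  set J : Finset (Fin n) := ξe.filter fun j => μ j = ν j ∧ ν j ≠ 0 ∧ s j < lam j - μ j with hJ
  have hc : ∀ j, ∃ c : Fin l → F, j ∈ J → c ≠ 0 ∧ ∀ p : Fin l → F[X],
      h j (fun i => (∏ j ∈ ξe, (X - C (α j)) ^ s j) * p i) ≠ 0 →
        (fun i => (p i).eval (α j)) ≠ c := by
    intro j
    by_cases hj : j ∈ J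
    · obtain ⟨hje, hμν, hν0, hsj⟩ := Finset.mem_filter.1 hj
      obtain ⟨c, hc0, hc⟩ := exists_forbidden_value (hW.mu_of_mem_e j hje).2 hν0
        (by omega) (hS j hje hν0) hμν (hω j) (hχ j)
        (eval_prod_X_sub_C_pow_ne_zero hα (m := s) (Finset.notMem_erase j ξe))
      refine ⟨c, fun _ => ⟨hc0, fun p hp => ?_⟩⟩
      rw [Finset.mul_prod_erase ξe (fun j => (X - C (α j)) ^ s j) hje] at hc
      obtain ⟨r, hr, hrel⟩ := hmem j hje _ hp
      exact hc p r hr hrel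
    · exact ⟨0, fun h => absurd h hj⟩
  choose c hc using hc
  have hmain := sum_prod_le hl hα (Finset.filter_subset _ ξe : J ⊆ ξe)
    (m := fun j => lam j - μ j) (s := s) (fun j _ => hs j) (c := c) (fun j hj => (hc j hj).1)
    (h := h) (fun j p => by positivity) ?_ ?_ (fun j hj => (hc j hj).2) P hP
  · refine le_trans (le_of_eq ?_) (mul_le_mul_of_nonneg_left hmain (Nat.cast_nonneg _))
    rw [Finset.mul_sum]
    refine Finset.sum_congr rfl fun p _ => ?_
    have h1 : {R ∈ errorModel f g ξe ξv μ W | ∀ j ∈ ξe,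
        ErrorRel (ν j) (μ j) (S j) p (χ j) (R j).vec} =
        Set.pi Set.univ fun j => {w ∈ localModel f g ξe ξv μ W j |
          j ∈ ξe → ErrorRel (ν j) (μ j) (S j) p (χ j) w.vec} := by
      rw [errorModel_eq_pi]
      ext R
      simp only [Set.mem_ofPred_eq, Set.mem_pi, Set.mem_univ, true_imp_iff]
      exact forall_and.symm
    have h2 : ∏ j ∈ ξe, h j p = ∏ j, if j ∈ ξe then h j p else 1 := by
      rw [Finset.prod_ite_mem, Finset.univ_inter]
    rw [h1, errorModel_eq_pi, ncard_pi, ncard_pi, Nat.cast_prod, Nat.cast_prod, h2,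
      ← Finset.prod_mul_distrib]
    refine Finset.prod_congr rfl fun j _ => ?_
    by_cases hj : j ∈ ξe
    · simp only [hj, true_imp_iff, if_true, hh]
      rw [mul_div_cancel₀ _ (hNpos j).ne']
    · simp [hj]
  · intro j hj p
    have h1 := ncard_errorRel_le (p := p) (by omega) (hW.mu_of_mem_e j hj).1
      (hW.mu_of_mem_e j hj).2 (hs j) (hS j hj) (hω j) (hχ j)
    have h2 : N j = (errorVecs (ν j) (μ j) (S j)).ncard := by
      simpa using ncard_localModel_sep (f := f) hW hj fun _ => True
    simp only [hh]
    rw [div_le_iff₀ (hNpos j), ncard_localModel_sep hW hj, h2]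
    refine h1.trans (le_of_eq ?_)
    simp only [Finset.mem_filter, hj, true_and]
    ring
  · intro j hj p hp i
    obtain ⟨r, hr, hrel⟩ := hmem j hj p hp
    exact pow_dvd_of_errorRel (hW.mu_of_mem_e j hj).1 (hW.mu_of_mem_e j hj).2 (hs j) (hχ j)
      hr hrel i

end

theorem ErrorRel.smul {l : ℕ} {a : F} {k ν μ : ℕ} {S r : Fin l → LocalRing a k}
    {p : Fin l → F[X]} {χ : F[X]} (h : ErrorRel ν μ S p χ r) (c : F) :
    ErrorRel ν μ S (c • p) (c • χ) r := by
  intro i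
  rw [Pi.smul_apply, smul_eq_C_mul, smul_eq_C_mul, red_mul, red_mul]
  linear_combination red a k (C c) * h i

section

variable {n l : ℕ} {α : Fin n → F} {lam : Fin n → ℕ} {f : Fin l → F[X]} {g : F[X]}
  {ξe ξv : Finset (Fin n)} {μ : Fin n → ℕ} {W : Word α lam l}

/-- The union bound over the pairs `(p, χ)`, in the form
`|bad| ≤ |model| q^(l D - (l - 1) d)` with `d` the degree of the evaluation error locator. Such pairs come in orbits of size `q - 1` under
`F^*`, which cancels the factor `q - 1` of the bound for each `χ`. -/
theorem ncard_bad_le [Finite F] (hl : 2 ≤ l) (hα : Function.Injective α)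
    (hfg : CoprimeFamily f g) (hW : IsErrorPattern g ξe ξv μ W) {D : ℕ}
    {bad : Set (Word α lam l)} (hbad : bad ⊆ errorModel f g ξe ξv μ W)
    (h : ∀ R ∈ bad, ∃ (p : Fin l → F[X]) (χ : Fin n → F[X]), p ≠ 0 ∧
      (∀ i, (p i).degree < (D : WithBot ℕ)) ∧
      ∀ j ∈ ξe, (χ j).degree < ((lam j - μ j : ℕ) : WithBot ℕ) ∧
        ErrorRel (polyVal (α j) (lam j) g) (μ j) (evVec (α j) (lam j) f g) p (χ j)
          (R j).vec) :
    (bad.ncard : ℝ) * ((Nat.card F : ℝ) ^ l) ^ (∑ j ∈ ξe, (lam j - μ j)) ≤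
      (errorModel f g ξe ξv μ W).ncard * ((Nat.card F : ℝ) ^ l) ^ D *
        (Nat.card F : ℝ) ^ (∑ j ∈ ξe, (lam j - μ j)) := by
  classical
  have hfinW : Finite (Word α lam l) := finite_word
  have hq : (1 : ℝ) < Nat.card F := by exact_mod_cast Finite.one_lt_card (α := F)
  set d := ∑ j ∈ ξe, (lam j - μ j) with hd
  set Rel : Word α lam l → (Fin l → F[X]) × (Fin n → F[X]) → Prop := fun R x =>
    ∀ j ∈ ξe, ErrorRel (polyVal (α j) (lam j) g) (μ j) (evVec (α j) (lam j) f g) x.1 (x.2 j)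
      (R j).vec with hRel
  -- the multipliers, extended by zero outside `ξe`
  set m : Fin n → ℕ := fun j => if j ∈ ξe then lam j - μ j else 0 with hm
  set X : Set (Fin n → F[X]) := Set.pi Set.univ fun j => (degreeLT F (m j) : Set F[X]) with hX
  have hXfin : X.Finite := Set.Finite.pi fun j => by
    have : Finite (degreeLT F (m j) : Set F[X]) := finite_degreeLT (F := F) (m j)
    exact Set.toFinite _
  have hXcard : X.ncard = Nat.card F ^ d := by
    rw [hX, ncard_pi, hd, ← Finset.univ_inter ξe, ← Finset.sum_ite_mem,
      ← Finset.prod_pow_eq_pow_sum]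
    exact Finset.prod_congr rfl fun j _ => card_degreeLT (m j)
  have hVfin := finite_vecLT (F := F) l D
  set P : Finset (Fin l → F[X]) := hVfin.toFinset.filter (· ≠ 0) with hP
  have hPmem : ∀ p, p ∈ P ↔ p ∈ vecLT F l D ∧ p ≠ 0 := by simp [hP]
  have hbfin : bad.Finite := Set.toFinite _
  have hupper : ∑ x ∈ P ×ˢ hXfin.toFinset,
      ({R ∈ errorModel f g ξe ξv μ W | Rel R x}.ncard : ℝ) ≤
      (Nat.card F : ℝ) ^ d * ((errorModel f g ξe ξv μ W).ncard *
        (((Nat.card F : ℝ) - 1) * ((Nat.card F : ℝ) ^ l) ^ D *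
          (((Nat.card F : ℝ) ^ l) ^ d)⁻¹)) := by
    rw [Finset.sum_product_right]
    refine (Finset.sum_le_card_nsmul _ _ _ fun χ _ =>
      sum_ncard_errorRel_le hl hα hfg hW χ P fun p hp => (hPmem p).1 hp).trans (le_of_eq ?_)
    rw [nsmul_eq_mul, ← Set.ncard_eq_toFinset_card X hXfin, hXcard, Nat.cast_pow]
  have hlower : ∀ R ∈ hbfin.toFinset,
      Nat.card F - 1 ≤ (Finset.bipartiteAbove Rel (P ×ˢ hXfin.toFinset) R).card := by
    intro R hR
    obtain ⟨p, χ, hp0, hpD, hrel⟩ := h R (hbfin.mem_toFinset.1 hR)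
    -- the pairs `(c p, c χ)` with `c` a nonzero constant all relate to `R`
    set χ' : Fin n → F[X] := fun j => if j ∈ ξe then χ j else 0 with hχ'
    have hχX : ∀ j, χ' j ∈ degreeLT F (m j) := by
      intro j
      simp only [hχ', hm]
      split_ifs with hj
      · exact mem_degreeLT.2 (hrel j hj).1
      · exact Submodule.zero_mem _
    have := Fintype.ofFinite F
    rw [Nat.card_eq_fintype_card, ← Fintype.card_units, ← Finset.card_univ]
    refine Finset.card_le_card_of_injOn (fun c : Fˣ => ((c : F) • p, (c : F) • χ')) ?_ ?_
    · intro c _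
      rw [Finset.mem_coe, Finset.mem_bipartiteAbove, Finset.mem_product, hPmem,
        hXfin.mem_toFinset]
      refine ⟨⟨⟨fun i => ?_, smul_ne_zero c.ne_zero hp0⟩, fun j _ => ?_⟩, fun j hj => ?_⟩
      · exact Submodule.smul_mem _ _ (mem_degreeLT.2 (hpD i))
      · exact Submodule.smul_mem _ _ (hχX j)
      · have h1 := (hrel j hj).2.smul (c : F)
        simpa only [Pi.smul_apply, hχ', hj, if_true] using h1
    · intro c _ c' _ hcc
      exact Units.ext (smul_left_injective F hp0 (congrArg Prod.fst hcc))
  have hcount := Finset.sum_card_bipartiteAbove_eq_sum_card_bipartiteBelow Rel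
    (s := hbfin.toFinset) (t := P ×ˢ hXfin.toFinset)
  have h1 : hbfin.toFinset.card * (Nat.card F - 1) ≤
      ∑ x ∈ P ×ˢ hXfin.toFinset, {R ∈ errorModel f g ξe ξv μ W | Rel R x}.ncard := by
    rw [← smul_eq_mul]
    refine (Finset.card_nsmul_le_sum _ _ _ hlower).trans (hcount.le.trans ?_)
    refine Finset.sum_le_sum fun x _ => ?_
    rw [← Set.ncard_coe_finset]
    refine Set.ncard_le_ncard (fun R hR => ?_) (Set.toFinite _)
    have := (Finset.mem_bipartiteBelow Rel).1 (Finset.mem_coe.1 hR)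
    exact ⟨hbad (hbfin.mem_toFinset.1 this.1), this.2⟩
  rw [← Set.ncard_eq_toFinset_card bad hbfin] at h1
  have h2 : (bad.ncard : ℝ) * ((Nat.card F : ℝ) - 1) ≤
      ∑ x ∈ P ×ˢ hXfin.toFinset, ({R ∈ errorModel f g ξe ξv μ W | Rel R x}.ncard : ℝ) := by
    have h3 : ((Nat.card F - 1 : ℕ) : ℝ) = (Nat.card F : ℝ) - 1 := by
      rw [Nat.cast_sub Finite.one_lt_card.le, Nat.cast_one]
    rw [← h3]
    exact_mod_cast h1
  have h3 := h2.trans hupper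
  have hQ : 0 < ((Nat.card F : ℝ) ^ l) ^ d := by positivity
  have h4 : (0 : ℝ) < (Nat.card F : ℝ) - 1 := by linarith
  refine le_of_mul_le_mul_right ?_ h4
  calc _ = (bad.ncard : ℝ) * ((Nat.card F : ℝ) - 1) * ((Nat.card F : ℝ) ^ l) ^ d := by ring
    _ ≤ _ := mul_le_mul_of_nonneg_right h3 hQ.le
    _ = _ := by
      field_simp

end

/-! ### The failure probability -/

theorem one_le_prod_div {q : ℝ} (hq : 1 < q) {l : ℕ} (hl : 0 < l) {P : F[X]} [DecidableEq F] :
    1 ≤ ∏ a ∈ P.roots.toFinset,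
      ((1 - 1 / q ^ (l + P.rootMultiplicity a)) / (1 - 1 / q ^ (l + 1))) := by
  refine Finset.prod_induction _ (fun x => 1 ≤ x)
    (fun _ _ => one_le_mul_of_one_le_of_one_le) le_rfl fun a ha => ?_
  rw [Multiset.mem_toFinset, ← Multiset.one_le_count_iff_mem, count_roots] at ha
  have h1 : 1 < q ^ (l + 1) := one_lt_pow₀ hq (by omega)
  have h2 : q ^ (l + 1) ≤ q ^ (l + P.rootMultiplicity a) := pow_le_pow_right₀ hq.le (by omega)
  rw [one_le_div (by rw [sub_pos, div_lt_one (by linarith)]; exact h1)]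
  have h3 : 1 / q ^ (l + P.rootMultiplicity a) ≤ 1 / q ^ (l + 1) :=
    one_div_le_one_div_of_le (by linarith) h2
  linarith

end SRFPoles

theorem theorem6 {F : Type*} [Field F] [Fintype F] [DecidableEq F] {n l : ℕ} (hl : 0 < l)
    (α : Fin n → F) (hα : Function.Injective α)
    (lam : Fin n → ℕ) (hlam : ∀ j, 0 < lam j)
    (L : ℕ) (hL : L = ∑ j, lam j)
    (df dg : ℕ) (hdf : 0 < df) (hdg : 0 < dg) (hd : df + dg ≤ L + 1)
    -- the distance parameter is `tv + te`
    (tv te : ℕ) (htv : (tv : ℤ) ≤ ⌊((L : ℝ) - df - dg + 1) / 2⌋)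
    (hte : (te : ℝ) ≤ SRFPoles.tbar l L df dg tv)
    -- the reduced vector of fractions `f / g`
    (f : Fin l → Polynomial F) (g : Polynomial F) (hg : g ≠ 0)
    (hfg : SRFPoles.CoprimeFamily f g)
    (hf_deg : ∀ i, (f i).degree < (df : WithBot ℕ)) (hg_deg : g.degree < (dg : WithBot ℕ))
    -- the parameters of the error model
    (ξe ξv : Finset (Fin n)) (μ : Fin n → ℕ) (W : SRFPoles.Word α lam l)
    (hW : SRFPoles.IsErrorPattern g ξe ξv μ W)
    (hv_deg : (SRFPoles.locator α lam μ ξv).natDegree ≤ tv)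
    (he_deg : (SRFPoles.locator α lam μ ξe).natDegree ≤ te) :
    (SRFPoles.errorModel f g ξe ξv μ W).Finite ∧
    (SRFPoles.errorModel f g ξe ξv μ W).Nonempty ∧
    SRFPoles.uniformProb (SRFPoles.errorModel f g ξe ξv μ W)
        (fun R => ¬ SRFPoles.DecodesTo df dg (tv + te) R f g) ≤
      (Fintype.card F : ℝ) ^ (-((l : ℝ) + 1) * (SRFPoles.tbar l L df dg tv - te)) *
        ∏ a ∈ (SRFPoles.locator α lam μ ξe).roots.toFinset,
          ((1 - 1 / (Fintype.card F : ℝ) ^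
              (l + (SRFPoles.locator α lam μ ξe).rootMultiplicity a)) /
            (1 - 1 / (Fintype.card F : ℝ) ^ (l + 1))) := by
  open SRFPoles in
  have hfin : Finite (Word α lam l) := finite_word
  have hne : (errorModel f g ξe ξv μ W).Nonempty := by
    rw [errorModel_eq_pi, Set.univ_pi_nonempty_iff]
    exact localModel_nonempty hl hfg hW
  refine ⟨Set.toFinite _, hne, ?_⟩
  have hq : (1 : ℝ) < Fintype.card F := by exact_mod_cast Fintype.one_lt_card (α := F)
  set q : ℝ := (Fintype.card F : ℝ) with hqdef
  have hpow : 0 < q ^ (-((l : ℝ) + 1) * (tbar l L df dg tv - te)) :=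
    Real.rpow_pos_of_pos (by linarith) _
  -- the product of the local factors is at least `1`, and the bound holds without it
  refine le_trans ?_ (le_mul_of_one_le_right hpow.le (one_le_prod_div hq hl))
  -- `A = L - df - dg + 1 - 2 tv`
  obtain ⟨A, hA⟩ : ∃ A : ℕ, L + 1 = df + dg + 2 * tv + A := by
    rw [Int.le_floor, le_div_iff₀ (by norm_num)] at htv
    have h1 : ((df + dg + 2 * tv : ℕ) : ℝ) ≤ ((L + 1 : ℕ) : ℝ) := by
      push_cast at htv ⊢
      linarith
    exact Nat.exists_eq_add_of_le (by exact_mod_cast h1)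
  have hAr : (L : ℝ) - df - dg + 1 - 2 * tv = A := by
    have : ((L + 1 : ℕ) : ℝ) = ((df + dg + 2 * tv + A : ℕ) : ℝ) := by rw [hA]
    push_cast at this
    linarith
  have htbar : ((l : ℝ) + 1) * tbar l L df dg tv = l * A := by
    unfold tbar
    rw [hAr]
    field_simp
  have hexp : -((l : ℝ) + 1) * (tbar l L df dg tv - te) = (l + 1) * te - l * A := by
    linear_combination -htbar
  have hteA : (l + 1) * te ≤ l * A := by
    have h1 := mul_le_mul_of_nonneg_left hte (by positivity : (0 : ℝ) ≤ (l : ℝ) + 1)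
    rw [htbar] at h1
    exact_mod_cast h1
  rw [hexp]
  unfold uniformProb
  set bad := {R ∈ errorModel f g ξe ξv μ W | ¬ DecodesTo df dg (tv + te) R f g} with hbad
  have hB : (0 : ℝ) < (errorModel f g ξe ξv μ W).ncard := by
    exact_mod_cast (Set.ncard_pos (Set.toFinite _)).2 hne
  rcases bad.eq_empty_or_nonempty with hemp | ⟨R₀, hR₀⟩
  · rw [hemp, Set.ncard_empty, Nat.cast_zero, zero_div]
    exact Real.rpow_nonneg (by linarith) _
  have hrel := fun R (hR : R ∈ bad) => exists_errorRel_of_not_decodesTo hl hα hg hfg hW hR.1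
    (hL ▸ hA) hf_deg hg_deg hv_deg he_deg hR.2
  set d := (locator α lam μ ξe).natDegree with hdd
  have hD : A < te + d := by
    obtain ⟨p, -, hp0, hp, -⟩ := hrel R₀ hR₀
    by_contra! hle
    refine hp0 (funext fun i => ?_)
    have := hp i
    rwa [Nat.sub_eq_zero_of_le hle, Nat.cast_zero, Nat.WithBot.lt_zero_iff, degree_eq_bot] at this
  -- for `l = 1` this is unique decoding
  have hl2 : 2 ≤ l := by
    by_contra! hlt
    obtain rfl : l = 1 := by omega
    omega
  have hmain := ncard_bad_le hl2 hα hfg hW (Set.sep_subset _ _) hrel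
  rw [← natDegree_locator α, ← hdd, Nat.card_eq_fintype_card, ← hqdef] at hmain
  rw [div_le_iff₀ hB]
  obtain ⟨D, hDD⟩ := Nat.exists_eq_add_of_lt hD
  have hQ : 0 < (q ^ l) ^ d := by positivity
  refine le_of_mul_le_mul_right (hmain.trans ?_) hQ
  have key : (q ^ l) ^ (te + d - A) * q ^ d ≤ q ^ ((l + 1) * te - l * A : ℝ) * (q ^ l) ^ d := by
    rw [← pow_mul, ← pow_mul, ← pow_add, ← Real.rpow_natCast, ← Real.rpow_natCast,
      ← Real.rpow_add (by linarith)]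
    refine Real.rpow_le_rpow_of_exponent_le hq.le ?_
    push_cast
    rw [Nat.cast_sub hD.le]
    have : (d : ℝ) ≤ te := by exact_mod_cast he_deg
    push_cast
    linarith
  calc _ = (errorModel f g ξe ξv μ W).ncard * ((q ^ l) ^ (te + d - A) * q ^ d) := by ring
    _ ≤ _ := mul_le_mul_of_nonneg_left key hB.le
    _ = _ := by ring
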